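/- Theorem A3. Let $n\ge 3$ and let $F$ be an infinite field of characteristic $\neq 2$. For a commutative ring $R$ let $T_n(R)$ be the group of invertible upper triangular $n\times n$ matrices over $R$, $UT_n(R)$ its normal subgroup of unitriangular matrices, and $B_n(R)=\{\operatorname{diag}(\alpha_1,\dots,\alpha_{n-1},1):\alpha_i\in R^\times\}\le T_n(R)$. For abelian groups $B,Z$ (written multiplicatively), let $S^2(B,Z)$ be the set of symmetric normalized 2-cocycles, that is, of functions $f:B\times B\to Z$ with $f(xy,z)f(x,y)=f(x,yz)f(y,z)$, $f(1,x)=f(x,1)=1$ and $f(x,y)=f(y,x)$ for all $x,y,z\in B$. For an abelian group $Z$ and $f\in S^2(B_n(R),Z)$ let $D_n(R,f,Z)$ be the set $Z\times B_n(R)$ with the multiplication $(z_1,b_1)(z_2,b_2)=(z_1z_2f(b_1,b_2),\,b_1b_2)$ (an abelian extension of $Z$ by $B_n(R)$), and let the abelian deformation $T_n(R,f,Z)$ be the semidirect product $UT_n(R)\rtimes D_n(R,f,Z)$ in which $(z,b)$ acts on $UT_n(R)$ by $u\mapsto bub^{-1}$. Let $H$ be any group that is elementarily equivalent to $T_n(F)$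 in the first-order language of groups, and let $Z=Z(H)$ be its center. Then there are a field $L$ that is elementarily equivalent to $F$ (in the language of rings) and a symmetric 2-cocycle $f\in S^2(B_n(L),Z)$ such that $H\cong T_n(L,f,Z)$. Moreover, $Z$ is elementarily equivalent, as a group, to $Z(T_n(F))\cong F^\times$, and so to $F^\times$. -/

import Mathlib

universe u v

namespace AbelianDeformation

/-! ### Elementary equivalence of groups and of fields -/

/-- The function symbols of the first-order language of groups. -/
inductive GroupFunc : ℕ → Type
  | mul : GroupFunc 2
  | inv : GroupFunc 1
  | one : GroupFunc 0

/-- The first-order language of groups: multiplication, inversion, identity. -/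
def groupLanguage : FirstOrder.Language :=
  { Functions := GroupFunc
    Relations := fun _ => Empty }

/-- A group, seen as a structure for the language of groups. -/
@[reducible]
def groupStructure (G : Type*) [Group G] : groupLanguage.Structure G :=
  { funMap := fun {n} f =>
      match n, f with
      | _, .mul => fun x => x 0 * x 1
      | _, .inv => fun x => (x 0)⁻¹
      | _, .one => fun _ => 1
    RelMap := fun r => nomatch r }

/-- Elementary equivalence of groups, in the language of groups. -/
def GroupElemEquiv (G H : Type*) [Group G] [Group H] : Prop :=
  letI := groupStructure G
  letI := groupStructure H
  groupLanguage.ElementarilyEquivalent G H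

/-- Elementary equivalence of fields, in the language of rings. -/
def FieldElemEquiv (K L : Type*) [Field K] [Field L] : Prop :=
  letI := FirstOrder.Ring.compatibleRingOfRing K
  letI := FirstOrder.Ring.compatibleRingOfRing L
  FirstOrder.Language.ring.ElementarilyEquivalent K L

/-! ### Triangular groups -/

section Triangular

variable (n : ℕ) (R : Type*) [CommRing R]

/-- `T_n(R)`: the group of invertible upper triangular `n × n` matrices over `R`. -/
def T : Subgroup (GL (Fin n) R) where
  carrier := {g | (g : Matrix (Fin n) (Fin n) R).IsUpperTriangular}
  one_mem' := Matrix.blockTriangular_one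
  mul_mem' {a b} ha hb := by
    have := Matrix.BlockTriangular.mul ha hb
    simpa using this
  inv_mem' {a} ha := by
    have : Invertible (a : Matrix (Fin n) (Fin n) R) := Units.invertible a
    have := Matrix.blockTriangular_inv_of_blockTriangular ha
    simpa [Matrix.coe_units_inv] using this

variable {n R}

/-- The `(i, j)` entry of a matrix in `T_n(R)`. -/
def entry (g : T n R) (i j : Fin n) : R := ((g : GL (Fin n) R) : Matrix (Fin n) (Fin n) R) i j

theorem entry_one (i j : Fin n) : entry (1 : T n R) i j = if i = j then 1 else 0 := by
  simp [entry, Matrix.one_apply]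

theorem entry_mul (g h : T n R) (i j : Fin n) :
    entry (g * h) i j = ∑ k, entry g i k * entry h k j := by
  simp [entry, Matrix.mul_apply]

theorem entry_of_lt (g : T n R) {i j : Fin n} (h : j < i) : entry g i j = 0 :=
  g.2 h

theorem entry_mul_diag (g h : T n R) (i : Fin n) :
    entry (g * h) i i = entry g i i * entry h i i := by
  rw [entry_mul]
  refine Finset.sum_eq_single i (fun k _ hk => ?_) (by simp)
  rcases lt_or_gt_of_ne hk with hk | hk
  · rw [entry_of_lt g hk, zero_mul]
  · rw [entry_of_lt h hk, mul_zero]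

theorem entry_inv_diag (g : T n R) (i : Fin n) : entry g i i * entry g⁻¹ i i = 1 := by
  rw [← entry_mul_diag, mul_inv_cancel, entry_one, if_pos rfl]

variable (n R)

/-- `UT_n(R)`: the upper unitriangular matrices, as a subgroup of `T_n(R)`. -/
def UT : Subgroup (T n R) where
  carrier := {g | ∀ i, entry g i i = 1}
  one_mem' i := by rw [entry_one, if_pos rfl]
  mul_mem' {a b} ha hb i := by rw [entry_mul_diag, ha i, hb i, mul_one]
  inv_mem' {a} ha i := by
    have := entry_inv_diag a i
    rwa [ha i, one_mul] at this

instance : (UT n R).Normal where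
  conj_mem u hu g i := by
    rw [entry_mul_diag, entry_mul_diag, hu i, mul_one, entry_inv_diag]

/-- `B_n(R)`: the diagonal matrices `diag(α₁, …, αₙ₋₁, 1)` with `α₁, …, αₙ₋₁` units of `R`, that is,
the product of the subgroups `d_i(Rˣ)` for `1 ≤ i ≤ n - 1`, as a subgroup of `T_n(R)`. -/
def B : Subgroup (T n R) where
  carrier := {g | (∀ i j, i ≠ j → entry g i j = 0) ∧ ∀ i : Fin n, (i : ℕ) + 1 = n → entry g i i = 1}
  one_mem' := ⟨fun i j h => by rw [entry_one, if_neg h], fun i _ => by rw [entry_one, if_pos rfl]⟩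
  mul_mem' {a b} ha hb := by
    refine ⟨fun i j h => ?_, fun i hi => by rw [entry_mul_diag, ha.2 i hi, hb.2 i hi, mul_one]⟩
    rw [entry_mul]
    refine Finset.sum_eq_zero fun k _ => ?_
    by_cases hk : i = k
    · subst hk
      rw [hb.1 _ _ h, mul_zero]
    · rw [ha.1 _ _ hk, zero_mul]
  inv_mem' {a} ha := by
    refine ⟨fun i j h => ?_, fun i hi => ?_⟩
    · have h1 : entry (a * a⁻¹) i j = 0 := by rw [mul_inv_cancel, entry_one, if_neg h]
      rw [entry_mul, Finset.sum_eq_single i (fun k _ hk => by rw [ha.1 _ _ hk.symm, zero_mul])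
        (by simp)] at h1
      calc entry a⁻¹ i j = entry a i i * entry a⁻¹ i i * entry a⁻¹ i j := by
            rw [entry_inv_diag, one_mul]
        _ = entry a⁻¹ i i * (entry a i i * entry a⁻¹ i j) := by ring
        _ = 0 := by rw [h1, mul_zero]
    · have := entry_inv_diag a i
      rwa [ha.2 i hi, one_mul] at this

instance : CommGroup (B n R) :=
  { (inferInstance : Group (B n R)) with
    mul_comm := fun a b => by
      apply Subtype.ext
      apply Subtype.ext
      apply Units.ext
      ext i j
      change entry ((a : T n R) * (b : T n R)) i j = entry ((b : T n R) * (a : T n R)) i j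
      by_cases h : i = j
      · subst h
        rw [entry_mul_diag, entry_mul_diag, mul_comm]
      · rw [((B n R).mul_mem a.2 b.2).1 i j h, ((B n R).mul_mem b.2 a.2).1 i j h] }

end Triangular

/-! ### Symmetric 2-cocycles and the abelian extensions they define -/

/-- `S²(B, Z)`: symmetric (normalized) 2-cocycles on an abelian group `B` with values in an abelian
group `Z` (with trivial action), both written multiplicatively. -/
structure SymmCocycle (B Z : Type*) [CommGroup B] [CommGroup Z] where
  /-- the underlying function of two variables -/
  toFun : B → B → Z
  cocycle : ∀ x y z, toFun (x * y) z * toFun x y = toFun x (y * z) * toFun y z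
  one_left : ∀ x, toFun 1 x = 1
  one_right : ∀ x, toFun x 1 = 1
  symm : ∀ x y, toFun x y = toFun y x

/-- The underlying set `Z × B` of the extension of `Z` by `B` defined by `f`. -/
@[ext]
structure AbExt {B Z : Type*} [CommGroup B] [CommGroup Z] (f : SymmCocycle B Z) where
  /-- the component in `Z` -/
  z : Z
  /-- the component in `B` -/
  b : B

namespace AbExt

variable {B Z : Type*} [CommGroup B] [CommGroup Z] (f : SymmCocycle B Z)

/-- The group law `(z₁, b₁)(z₂, b₂) = (z₁ z₂ f(b₁, b₂), b₁ b₂)`. -/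
instance : Mul (AbExt f) := ⟨fun x y => ⟨x.z * y.z * f.toFun x.b y.b, x.b * y.b⟩⟩

instance : One (AbExt f) := ⟨⟨1, 1⟩⟩

instance : Inv (AbExt f) := ⟨fun x => ⟨x.z⁻¹ * (f.toFun x.b⁻¹ x.b)⁻¹, x.b⁻¹⟩⟩

theorem mul_def (x y : AbExt f) :
    x * y = ⟨x.z * y.z * f.toFun x.b y.b, x.b * y.b⟩ := rfl

theorem one_def : (1 : AbExt f) = ⟨1, 1⟩ := rfl

theorem inv_def (x : AbExt f) : x⁻¹ = ⟨x.z⁻¹ * (f.toFun x.b⁻¹ x.b)⁻¹, x.b⁻¹⟩ := rfl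

instance : CommGroup (AbExt f) where
  mul_assoc x y w := by
    ext
    · simp only [mul_def]
      have := f.cocycle x.b y.b w.b
      calc x.z * y.z * f.toFun x.b y.b * w.z * f.toFun (x.b * y.b) w.b
          = x.z * y.z * w.z * (f.toFun (x.b * y.b) w.b * f.toFun x.b y.b) := by
            simp only [mul_assoc, mul_comm, mul_left_comm]
        _ = x.z * (y.z * w.z * f.toFun y.b w.b) * f.toFun x.b (y.b * w.b) := by
            rw [this]
            simp only [mul_assoc, mul_comm, mul_left_comm]
    · simp only [mul_def, mul_assoc]
  one_mul x := by
    ext <;> simp [mul_def, one_def, f.one_left]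
  mul_one x := by
    ext <;> simp [mul_def, one_def, f.one_right]
  inv_mul_cancel x := by
    ext
    · simp [mul_def, one_def, inv_def, mul_comm]
    · simp [mul_def, one_def, inv_def]
  mul_comm x y := by
    ext
    · simp only [mul_def, f.symm x.b y.b, mul_comm x.z y.z]
    · simp only [mul_def, mul_comm]

/-- The projection of the extension onto `B`; its kernel is the copy `{(z, 1)}` of `Z`. -/
def proj : AbExt f →* B where
  toFun x := x.b
  map_one' := rfl
  map_mul' _ _ := rfl

end AbExt

/-! ### Abelian deformations of `T_n(R)` -/

section Deformation

variable {n : ℕ} {R : Type*} [CommRing R] {Z : Type*} [CommGroup Z]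

/-- The deformed torus `D_n(R, f, Z)`: the abelian extension of `Z` by `B_n(R)` defined by `f`. -/
abbrev DeformedTorus (f : SymmCocycle (B n R) Z) : Type _ := AbExt f

/-- The action of `D_n(R, f, Z)` on `UT_n(R)`: the element `(z, b)` sends `u` to `b u b⁻¹`. -/
def torusAction (f : SymmCocycle (B n R) Z) : DeformedTorus f →* MulAut (UT n R) :=
  (MulAut.conjNormal.comp (B n R).subtype).comp (AbExt.proj f)

/-- The abelian deformation `T_n(R, f, Z) = UT_n(R) ⋊ D_n(R, f, Z)`. -/
abbrev DeformedT (f : SymmCocycle (B n R) Z) : Type _ :=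
  UT n R ⋊[torusAction f] DeformedTorus f

end Deformation

end AbelianDeformation

-- makes the center of a group a `CommGroup`
open scoped IsMulCommutative

namespace AbelianDeformation

/-! ### Definability with parameters along a map of structures -/

section Definability

open FirstOrder FirstOrder.Language

variable {L : FirstOrder.Language.{0, 0}} {M N : Type*} [L.Structure N] {f : M → N}
  {α β ι : Type*}

/-! A compactness argument embeds `H` elementarily into an ultrapower of `T_n(F)`, and this
ultrapower is `T_n(K)` for the ultrapower `K` of `F` (`exists_elementaryEmbedding_T`). So `H`
becomes an elementary subgroup of a group of matrices. One principle then does the model theory: a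
nonempty set of finite tuples that is definable with parameters from `H` contains a tuple from `H`
(`DefPred.exists_point`).

Over an infinite field `UT_n(K)` is the set of commutators, and the diagonal group is the
centralizer of any diagonal matrix with distinct entries. Since such regular elements are
characterized by their centralizers in `UT_n(K)`, `H` contains one, and conjugating the embedding
makes it diagonal. A definable description of transvections shows that `H` meets every root subgroup
nontrivially, and a diagonal conjugation rescales until all transvections with parameter 1 lie in
`H` (`exists_isFrame`).

With `i < j < k`, the commutator of `1 + a Eᵢⱼ` and `1 + b Eⱼₖ` is `1 + ab Eᵢₖ`. Hence the
parameters of the transvections in `H` form one subfield `S` of `K`, the same for all roots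
(`IsFrame.exists_subfield`). The ring structure of `K` is definable on a root subgroup, which gives
`S ≡ K`; applied to the diagonal copy of `T_n(F)` the same argument gives `F ≡ K`. The centers are
compared in the same way.

Finally, the unitriangular elements of `H` are those with entries in `S` (`mem_iff_entries_mem`),
each element of `H` is a unitriangular one times a diagonal one, and dividing a diagonal matrix by
its last entry maps the diagonal part of `H` onto `B_n(S)` with kernel the center. The diagonal part
is thus an abelian extension of the center by `B_n(S)`; a normalized section yields the symmetric
cocycle (`exists_symmCocycle_mulEquiv`). -/

variable (L) in
/-- `P` is definable in `N` with parameters from the image of `f`. -/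
def DefPred (f : M → N) (P : (α → N) → Prop) : Prop :=
  ∃ φ : L.Formula (M ⊕ α), ∀ v, φ.Realize (Sum.elim f v) ↔ P v

variable (L) in
/-- `τ` is given by a term with parameters from the image of `f`. -/
def DefTerm (f : M → N) (τ : (α → N) → N) : Prop :=
  ∃ t : L.Term (M ⊕ α), ∀ v, t.realize (Sum.elim f v) = τ v

theorem DefTerm.var (a : α) : DefTerm L f (fun v : α → N => v a) :=
  ⟨.var (.inr a), fun _ => rfl⟩

theorem DefTerm.param (m : M) : DefTerm L f (fun _ : α → N => f m) :=
  ⟨.var (.inl m), fun _ => rfl⟩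

theorem DefTerm.func {n : ℕ} (F : L.Functions n) {τ : Fin n → (α → N) → N}
    (h : ∀ i, DefTerm L f (τ i)) : DefTerm L f (fun v => Structure.funMap F fun i => τ i v) := by
  choose t ht using h
  exact ⟨.func F t, fun v => by simp [ht]⟩

theorem DefPred.congr {P Q : (α → N) → Prop} (h : DefPred L f P) (hPQ : ∀ v, P v ↔ Q v) :
    DefPred L f Q := by
  obtain ⟨φ, hφ⟩ := h
  exact ⟨φ, fun v => (hφ v).trans (hPQ v)⟩

theorem DefPred.eq {τ σ : (α → N) → N} (hτ : DefTerm L f τ) (hσ : DefTerm L f σ) :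
    DefPred L f (fun v => τ v = σ v) := by
  obtain ⟨t, ht⟩ := hτ
  obtain ⟨s, hs⟩ := hσ
  exact ⟨t.equal s, fun v => by rw [Formula.realize_equal, ht, hs]⟩

theorem DefPred.not {P : (α → N) → Prop} (h : DefPred L f P) : DefPred L f (fun v => ¬P v) := by
  obtain ⟨φ, hφ⟩ := h
  exact ⟨φ.not, fun v => by rw [Formula.realize_not, hφ]⟩

theorem DefPred.and {P Q : (α → N) → Prop} (hP : DefPred L f P) (hQ : DefPred L f Q) :
    DefPred L f (fun v => P v ∧ Q v) := by
  obtain ⟨φ, hφ⟩ := hP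
  obtain ⟨ψ, hψ⟩ := hQ
  exact ⟨φ ⊓ ψ, fun v => by rw [Formula.realize_inf, hφ, hψ]⟩

theorem DefPred.imp {P Q : (α → N) → Prop} (hP : DefPred L f P) (hQ : DefPred L f Q) :
    DefPred L f (fun v => P v → Q v) := by
  obtain ⟨φ, hφ⟩ := hP
  obtain ⟨ψ, hψ⟩ := hQ
  exact ⟨φ.imp ψ, fun v => by rw [Formula.realize_imp, hφ, hψ]⟩

theorem DefPred.or {P Q : (α → N) → Prop} (hP : DefPred L f P) (hQ : DefPred L f Q) :
    DefPred L f (fun v => P v ∨ Q v) :=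
  (hP.not.imp hQ).congr fun _ => or_iff_not_imp_left.symm

theorem DefPred.forall_finite [Finite ι] {P : ι → (α → N) → Prop} (h : ∀ i, DefPred L f (P i)) :
    DefPred L f (fun v => ∀ i, P i v) := by
  choose φ hφ using h
  exact ⟨Formula.iInf φ, fun v => by simp [hφ]⟩

theorem DefPred.exists_tuple [Finite β] {P : (α → N) → (β → N) → Prop}
    (h : DefPred L f (fun w : α ⊕ β → N => P (fun a => w (.inl a)) (fun b => w (.inr b)))) :
    DefPred L f (fun v => ∃ x, P v x) := by
  obtain ⟨φ, hφ⟩ := h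
  refine ⟨Formula.iExs β (φ.relabel (Equiv.sumAssoc M α β).symm), fun v => ?_⟩
  rw [Formula.realize_iExs]
  refine exists_congr fun x => ?_
  rw [Formula.realize_relabel]
  refine (iff_of_eq (congrArg _ ?_)).trans (hφ (Sum.elim v x))
  ext (m | a | b) <;> rfl

theorem DefPred.exists_one {P : (α → N) → N → Prop}
    (h : DefPred L f (fun w : α ⊕ Unit → N => P (fun a => w (.inl a)) (w (.inr ())))) :
    DefPred L f (fun v => ∃ x, P v x) :=
  (DefPred.exists_tuple (β := Unit) (P := fun v x => P v (x ())) h).congr fun _ =>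
    ⟨fun ⟨x, hx⟩ => ⟨x (), hx⟩, fun ⟨x, hx⟩ => ⟨fun _ => x, hx⟩⟩

theorem DefPred.forall_one {P : (α → N) → N → Prop}
    (h : DefPred L f (fun w : α ⊕ Unit → N => P (fun a => w (.inl a)) (w (.inr ())))) :
    DefPred L f (fun v => ∀ x, P v x) :=
  (DefPred.exists_one (P := fun v x => ¬P v x) h.not).not.congr fun _ => by simp

theorem DefPred.subst {Q : (β → N) → Prop} (h : DefPred L f Q) {τ : β → (α → N) → N}
    (hτ : ∀ b, DefTerm L f (τ b)) : DefPred L f (fun v => Q (fun b => τ b v)) := by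
  obtain ⟨φ, hφ⟩ := h
  choose t ht using hτ
  refine ⟨BoundedFormula.subst φ (Sum.elim (fun m => .var (.inl m)) t), fun v => ?_⟩
  rw [Formula.Realize, BoundedFormula.realize_subst]
  refine (iff_of_eq (congrArg (fun w => BoundedFormula.Realize φ w default) ?_)).trans (hφ _)
  ext (m | b)
  · rfl
  · exact ht b v

/-- The Tarski–Vaught property of an elementary embedding. -/
theorem DefPred.exists_point {M : Type*} [L.Structure M] (f : M ↪ₑ[L] N) [Finite β]
    {P : (β → N) → Prop} (h : DefPred L f P) (hP : ∃ v, P v) : ∃ w : β → M, P (f ∘ w) := by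
  obtain ⟨φ, hφ⟩ := h
  -- The elements of `M` serve as variables of `φ` naming themselves, so the identity valuation of
  -- `M` is carried by `f` to the valuation of the parameters.
  have h1 : (Formula.iExs β φ).Realize (f ∘ (id : M → M)) := by
    rw [Formula.realize_iExs]
    obtain ⟨v, hv⟩ := hP
    exact ⟨v, (hφ v).2 hv⟩
  rw [f.map_formula, Formula.realize_iExs] at h1
  obtain ⟨w, hw⟩ := h1
  refine ⟨w, (hφ _).1 ?_⟩
  rw [← f.map_formula] at hw
  convert hw using 1
  ext (m | b) <;> rfl

theorem DefPred.exists_point_one {M : Type*} [L.Structure M] (f : M ↪ₑ[L] N)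
    {P : N → Prop} (h : DefPred L f (fun v : Unit → N => P (v ()))) (hP : ∃ x, P x) :
    ∃ m : M, P (f m) := by
  obtain ⟨x, hx⟩ := hP
  obtain ⟨w, hw⟩ := h.exists_point f ⟨fun _ => x, hx⟩
  exact ⟨w (), hw⟩

end Definability

/-! ### Structures interpreted on a definable set -/

section Interpretation

open FirstOrder FirstOrder.Language

variable {L L₁ : FirstOrder.Language.{0, 0}} {M N A : Type*} [L.Structure N] [L₁.Structure A]
  {f : M → N} {j : A → N} {α β ι : Type*}

variable (L) in
/-- The relation `P` on `A` is, through the coding `j`, definable in `N` with parameters from the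
image of `f`. -/
def Coded (f : M → N) (j : A → N) (P : (α → A) → Prop) : Prop :=
  ∃ Q : (α → N) → Prop, DefPred L f Q ∧ ∀ a, Q (fun i => j (a i)) ↔ P a

theorem Coded.congr {P Q : (α → A) → Prop} (h : Coded L f j P) (hPQ : ∀ v, P v ↔ Q v) :
    Coded L f j Q := by
  obtain ⟨R, hR, h'⟩ := h
  exact ⟨R, hR, fun a => (h' a).trans (hPQ a)⟩

theorem Coded.and {P Q : (α → A) → Prop} (hP : Coded L f j P) (hQ : Coded L f j Q) :
    Coded L f j (fun a => P a ∧ Q a) := by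
  obtain ⟨R, hR, h⟩ := hP
  obtain ⟨S, hS, h'⟩ := hQ
  exact ⟨_, hR.and hS, fun a => and_congr (h a) (h' a)⟩

theorem Coded.imp {P Q : (α → A) → Prop} (hP : Coded L f j P) (hQ : Coded L f j Q) :
    Coded L f j (fun a => P a → Q a) := by
  obtain ⟨R, hR, h⟩ := hP
  obtain ⟨S, hS, h'⟩ := hQ
  exact ⟨_, hR.imp hS, fun a => imp_congr (h a) (h' a)⟩

theorem Coded.not {P : (α → A) → Prop} (hP : Coded L f j P) : Coded L f j (fun a => ¬P a) := by
  obtain ⟨R, hR, h⟩ := hP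
  exact ⟨_, hR.not, fun a => not_congr (h a)⟩

theorem Coded.forall_finite [Finite ι] {P : ι → (α → A) → Prop} (h : ∀ i, Coded L f j (P i)) :
    Coded L f j (fun a => ∀ i, P i a) := by
  choose R hR h' using h
  exact ⟨_, DefPred.forall_finite hR, fun a => forall_congr' fun i => h' i a⟩

theorem Coded.relabel {P : (β → A) → Prop} (h : Coded L f j P) (g : β → α) :
    Coded L f j (fun a => P (fun b => a (g b))) := by
  obtain ⟨R, hR, h'⟩ := h
  exact ⟨_, hR.subst fun b => DefTerm.var (g b), fun a => h' _⟩

theorem Coded.eq (hj : Function.Injective j) (i k : α) : Coded L f j (fun a => a i = a k) :=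
  ⟨_, DefPred.eq (DefTerm.var i) (DefTerm.var k), fun _ => hj.eq_iff⟩

theorem Coded.exists_tuple [Finite β]
    (hdom : DefPred L f (fun v : Unit → N => v () ∈ Set.range j)) {P : (α → A) → (β → A) → Prop}
    (h : Coded L f j (fun a : α ⊕ β → A => P (fun i => a (.inl i)) (fun i => a (.inr i)))) :
    Coded L f j (fun a => ∃ x, P a x) := by
  obtain ⟨R, hR, h'⟩ := h
  refine ⟨fun v => ∃ x : β → N, (∀ b, x b ∈ Set.range j) ∧ R (Sum.elim v x),
    DefPred.exists_tuple (DefPred.and (DefPred.forall_finite fun b =>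
      hdom.subst fun _ => DefTerm.var (Sum.inr b)) (hR.congr fun w => ?_)), fun a => ?_⟩
  · refine iff_of_eq (congrArg R ?_)
    ext (a | b) <;> rfl
  · constructor
    · rintro ⟨x, hx, hRx⟩
      choose y hy using hx
      refine ⟨y, (h' (Sum.elim a y)).1 ?_⟩
      convert hRx using 1
      ext (i | i)
      · rfl
      · exact hy i
    · rintro ⟨y, hy⟩
      refine ⟨fun b => j (y b), fun b => ⟨_, rfl⟩, ?_⟩
      have := (h' (Sum.elim a y)).2 hy
      convert this using 1
      ext (i | i) <;> rfl

/-- A term of the coded structure has no counterpart as a term of `N`, since operations are coded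
only by their graphs. Hence nested terms are unfolded by quantifying over the intermediate values.
-/
theorem Coded.term (hj : Function.Injective j)
    (hdom : DefPred L f (fun v : Unit → N => v () ∈ Set.range j))
    (hfun : ∀ (n : ℕ) (F : L₁.Functions n), Coded L f j (fun a : Fin n ⊕ Unit → A =>
      a (.inr ()) = Structure.funMap F fun i => a (.inl i))) (t : L₁.Term α) :
    Coded L f j (fun a : α ⊕ Unit → A => a (.inr ()) = t.realize fun i => a (.inl i)) := by
  induction t with
  | var i => exact Coded.eq hj _ _
  | @func k F ts ih =>
    refine (Coded.exists_tuple (β := Fin k) hdom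
      (P := fun (a : α ⊕ Unit → A) (c : Fin k → A) =>
        (∀ i, c i = (ts i).realize fun i => a (.inl i)) ∧ a (.inr ()) = Structure.funMap F c)
      (Coded.and (Coded.forall_finite fun i => ?_) ?_)).congr fun a => ?_
    · exact (ih i).relabel
        (Sum.elim (fun x => .inl (.inl x)) fun _ => .inr i :
          α ⊕ Unit → (α ⊕ Unit) ⊕ Fin k)
    · exact (hfun k F).relabel
        (Sum.elim .inr fun _ => .inl (.inr ()) : Fin k ⊕ Unit → (α ⊕ Unit) ⊕ Fin k)
    · constructor
      · rintro ⟨c, hc, h⟩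
        rw [h, Term.realize]
        congr 1
        ext i
        exact hc i
      · intro h
        exact ⟨_, fun i => rfl, h⟩

theorem Coded.boundedFormula [L₁.IsAlgebraic] (hj : Function.Injective j)
    (hdom : DefPred L f (fun v : Unit → N => v () ∈ Set.range j))
    (hfun : ∀ (n : ℕ) (F : L₁.Functions n), Coded L f j (fun a : Fin n ⊕ Unit → A =>
      a (.inr ()) = Structure.funMap F fun i => a (.inl i))) {n : ℕ} (φ : L₁.BoundedFormula α n) :
    Coded L f j (fun a : α ⊕ Fin n → A =>
      φ.Realize (fun i => a (.inl i)) (fun i => a (.inr i))) := by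
  induction φ with
  | falsum =>
    exact ⟨fun _ => False, ⟨⊥, fun v => Iff.rfl⟩, fun _ => Iff.rfl⟩
  | equal t s =>
    refine (Coded.exists_tuple (β := Unit) hdom
      (P := fun a x => x () = t.realize a ∧ x () = s.realize a) (Coded.and ?_ ?_)).congr
        fun a => ?_
    · exact Coded.term hj hdom hfun t
    · exact Coded.term hj hdom hfun s
    · have : a = Sum.elim (fun i => a (.inl i)) (fun i => a (.inr i)) := by
        ext (i | i) <;> rfl
      rw [BoundedFormula.Realize, ← this]
      exact ⟨fun ⟨x, h, h'⟩ => h.symm.trans h', fun h => ⟨fun _ => t.realize a, rfl, h⟩⟩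
  | rel R => exact isEmptyElim R
  | imp _ _ ih ih' => exact ih.imp ih'
  | @all n φ ih =>
    refine (Coded.exists_tuple (β := Unit) hdom (P := fun (a : α ⊕ Fin n → A) x =>
      ¬φ.Realize (fun i => a (.inl i)) (Fin.snoc (fun i => a (.inr i)) (x ())))
      (Coded.not ?_)).not.congr fun a => ?_
    · refine (ih.relabel (Sum.elim (fun i => .inl (.inl i))
        (Fin.snoc (fun i => .inl (.inr i)) (.inr ())) :
          α ⊕ Fin (n + 1) → (α ⊕ Fin n) ⊕ Unit)).congr fun a => ?_
      refine iff_of_eq (congrArg (BoundedFormula.Realize φ _) ?_)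
      ext i
      refine Fin.lastCases ?_ (fun i => ?_) i <;> simp
    · rw [BoundedFormula.realize_all]
      push Not
      exact ⟨fun h x => h fun _ => x, fun h x => h (x ())⟩

/-- If an elementary substructure `M` of `N` meets the coded structure `A` in a substructure `A₀`,
then `A₀` is elementarily equivalent to `A`. -/
theorem elementarilyEquivalent_of_coded {A₀ M : Type*} [L₁.Structure A₀] [L.Structure M]
    [L₁.IsAlgebraic] (f : M ↪ₑ[L] N) (κ : A₀ ↪[L₁] A) (hj : Function.Injective j)
    (hdom : DefPred L f (fun v : Unit → N => v () ∈ Set.range j))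
    (hfun : ∀ (n : ℕ) (F : L₁.Functions n), Coded L f j (fun a : Fin n ⊕ Unit → A =>
      a (.inr ()) = Structure.funMap F fun i => a (.inl i)))
    (hκ : ∀ a, (∃ m, f m = j a) ↔ ∃ a₀, κ a₀ = a) : L₁.ElementarilyEquivalent A₀ A := by
  -- Tarski–Vaught test for `κ`: a witness `a` for `φ` in `A` has to be replaced by one from `A₀`.
  -- The formula is translated into `N`, where the elementarity of `f` supplies a witness in its
  -- image.
  refine (κ.toElementaryEmbedding fun n φ x a ha => ?_).elementarilyEquivalent
  obtain ⟨Q, hQ, hQφ⟩ := Coded.boundedFormula hj hdom hfun φ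
  choose m hm using fun i => (hκ (κ (x i))).2 ⟨_, rfl⟩
  have key : ∀ b : A, Q (Sum.elim Empty.elim (Fin.snoc (fun i => f (m i)) (j b))) ↔
      φ.Realize default (Fin.snoc (κ ∘ x) b) := by
    intro b
    rw [← Subsingleton.elim (Empty.elim : Empty → A) default]
    refine Iff.trans (iff_of_eq (congrArg Q ?_))
      (hQφ (Sum.elim Empty.elim (Fin.snoc (κ ∘ x) b)))
    ext (i | i)
    · exact i.elim
    · refine Fin.lastCases ?_ (fun i => ?_) i <;> simp [hm]
  have hD : DefPred L f (fun v : Unit → N => v () ∈ Set.range j ∧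
      Q (Sum.elim Empty.elim (Fin.snoc (fun i => f (m i)) (v ())))) := by
    refine hdom.and ((hQ.subst (τ := Sum.elim (fun e => e.elim)
      (Fin.snoc (fun i _ => f (m i)) fun v => v ())) ?_).congr fun v => ?_)
    · rintro (e | i)
      · exact e.elim
      · refine Fin.lastCases ?_ (fun i => ?_) i
        · simpa using DefTerm.var ()
        · simpa using DefTerm.param (m i)
    · refine iff_of_eq (congrArg Q ?_)
      ext (e | i)
      · exact e.elim
      · refine Fin.lastCases ?_ (fun i => ?_) i <;> simp
  obtain ⟨y, ⟨b, hb⟩, hy⟩ := DefPred.exists_point_one f hD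
    (P := fun y => y ∈ Set.range j ∧ Q (Sum.elim Empty.elim (Fin.snoc (fun i => f (m i)) y)))
    ⟨j a, ⟨a, rfl⟩, (key a).2 ha⟩
  obtain ⟨b₀, rfl⟩ := (hκ b).1 ⟨y, hb.symm⟩
  exact ⟨b₀, (key _).1 (hb ▸ hy)⟩

end Interpretation

/-! ### Upper triangular matrices over a field -/

section MatrixForm

variable {n : ℕ} {K : Type*} [Field K]

/-- The underlying matrix of an element of `T n K`. -/
def mat (g : T n K) : Matrix (Fin n) (Fin n) K := ((g : GL (Fin n) K) : Matrix (Fin n) (Fin n) K)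

theorem mat_injective : Function.Injective (mat : T n K → Matrix (Fin n) (Fin n) K) :=
  fun _ _ h => Subtype.ext (Units.ext h)

theorem mat_inj {g h : T n K} : mat g = mat h ↔ g = h := mat_injective.eq_iff

theorem mat_mul (g h : T n K) : mat (g * h) = mat g * mat h := rfl

theorem mat_one : mat (1 : T n K) = 1 := rfl

theorem mat_upper (g : T n K) {i j : Fin n} (h : j < i) : mat g i j = 0 := g.2 h

theorem mat_mul_diag (g h : T n K) (i : Fin n) : mat (g * h) i i = mat g i i * mat h i i :=
  entry_mul_diag g h i

theorem mat_diag_ne_zero (g : T n K) (i : Fin n) : mat g i i ≠ 0 := by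
  intro h
  have := entry_inv_diag g i
  rw [show entry g i i = 0 from h, zero_mul] at this
  exact zero_ne_one this

theorem mat_inv_diag (g : T n K) (i : Fin n) : mat g⁻¹ i i = (mat g i i)⁻¹ :=
  (inv_eq_of_mul_eq_one_right (entry_inv_diag g i)).symm

open Classical in
/-- The element of `T n K` with a given matrix (`1` if the matrix is not invertible upper
triangular). -/
noncomputable def ofMat (M : Matrix (Fin n) (Fin n) K) : T n K :=
  if h : M.IsUpperTriangular ∧ ∀ i, M i i ≠ 0 then
    ⟨Matrix.GeneralLinearGroup.mkOfDetNeZero M (by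
      rw [Matrix.det_of_isUpperTriangular h.1]
      exact Finset.prod_ne_zero_iff.2 fun i _ => h.2 i), h.1⟩
  else 1

theorem mat_ofMat {M : Matrix (Fin n) (Fin n) K} (h : ∀ i j, j < i → M i j = 0)
    (hd : ∀ i, M i i ≠ 0) : mat (ofMat M) = M := by
  rw [ofMat, dif_pos ⟨fun i j hij => h i j hij, hd⟩]
  rfl

end MatrixForm

/-! ### Ultrapowers -/

section Ultrapower

open FirstOrder FirstOrder.Language Filter

/-- The variable type may be infinite, so only the finitely many free variables of `φ` are
quantified; the others get arbitrary values. -/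
theorem exists_realize_iff {L : FirstOrder.Language.{0, 0}} {α M : Type*} [DecidableEq α]
    [L.Structure M] [Nonempty M] {φ : L.Formula α} :
    (∃ c : α → M, φ.Realize c) ↔ φ.exClosure.Realize M := by
  rw [Formula.realize_exClosure]
  constructor
  · rintro ⟨c, hc⟩
    exact ⟨fun a => c a, (BoundedFormula.realize_restrictFreeVar (φ := φ) (f := id)
      (v := fun a => c a) c fun _ => rfl).2 hc⟩
  · rintro ⟨v, hv⟩
    let c : α → M := fun a => if h : a ∈ φ.freeVarFinset then v ⟨a, h⟩ else Classical.arbitrary M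
    exact ⟨c, (BoundedFormula.realize_restrictFreeVar c (by grind)).1 hv⟩

/-- An elementarily equivalent structure embeds elementarily into an ultrapower. -/
theorem exists_elementaryEmbedding_ultrapower {L : FirstOrder.Language.{0, 0}} {H : Type v}
    {G : Type u} [L.Structure H] [L.Structure G] [Nonempty G]
    (h : L.ElementarilyEquivalent H G) :
    ∃ (I : Type v) (U : Ultrafilter I), Nonempty (H ↪ₑ[L] (U : Filter I).Product fun _ => G) := by
  classical
  -- This is the elementary diagram of `H`, with the elements of `H` as variables. Each finite part
  -- is satisfied in `G` by some valuation `c s`; the ultraproduct over finite parts satisfies all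
  -- of it.
  let Φ := {φ : L.Formula H // φ.Realize id}
  have hc : ∀ s : Finset Φ, ∃ c : H → G, ∀ φ ∈ s, (φ : Φ).1.Realize c := by
    intro s
    have h1 : (Formula.iInf fun φ : s => φ.1.1).Realize (id : H → H) := by
      rw [Formula.realize_iInf]
      exact fun φ => φ.1.2
    have : Nonempty H := h.symm.nonempty
    obtain ⟨c, hc⟩ := exists_realize_iff.2 ((h.realize_sentence _).1 (exists_realize_iff.1 ⟨id, h1⟩))
    rw [Formula.realize_iInf] at hc
    exact ⟨c, fun φ hφ => hc ⟨φ, hφ⟩⟩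
  choose c hc using hc
  let U : Ultrafilter (Finset Φ) := Ultrafilter.of atTop
  have hU : ∀ φ : L.Formula H, φ.Realize id → ∀ᶠ s in U, φ.Realize (c s) := by
    intro φ hφ
    have : ∀ᶠ s in (atTop : Filter (Finset Φ)), φ.Realize (c s) := by
      filter_upwards [eventually_ge_atTop {⟨φ, hφ⟩}] with s hs
      exact hc s _ (hs (Finset.mem_singleton_self _))
    exact Ultrafilter.of_le _ this
  have hU' : ∀ φ : L.Formula H, (∀ᶠ s in U, φ.Realize (c s)) ↔ φ.Realize id := by
    intro φ
    refine ⟨fun hφ => ?_, hU φ⟩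
    by_contra hn
    have := hU φ.not hn
    obtain ⟨s, hs, hs'⟩ := (hφ.and this).exists
    exact hs' hs
  let q : (Finset Φ → G) → (U : Filter (Finset Φ)).Product fun _ => G := fun g => g
  refine ⟨_, U, ⟨⟨fun x => q fun s => c s x, fun k φ x => ?_⟩⟩⟩
  have h1 := Ultraproduct.realize_formula_cast (u := U) (M := fun _ => G) φ
    (fun i s => c s (x i))
  refine h1.trans ?_
  have h2 := hU' (φ.relabel x)
  simpa only [Formula.realize_relabel, Function.comp_def, id] using h2

/-- The diagonal embedding into an ultrapower. -/
def diagonalEmbedding (L : FirstOrder.Language.{0, 0}) {I : Type*} (U : Ultrafilter I)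
    (G : Type*) [L.Structure G] [Nonempty G] : G ↪ₑ[L] (U : Filter I).Product fun _ => G where
  toFun x := ((fun _ => x : I → G) : (U : Filter I).Product fun _ => G)
  map_formula' k φ x := by
    refine (Ultraproduct.realize_formula_cast (u := U) (M := fun _ => G) φ
      (fun i _ => x i)).trans ?_
    simp

variable {n : ℕ} {F K : Type*} [Field F] [Field K] {I : Type*} {U : Ultrafilter I}
  {ρ : (I → F) →+* K}

/-- The matrix over an ultrapower of a field that a family of matrices defines. -/
noncomputable def ultraT (ρ : (I → F) →+* K) (g : I → T n F) : T n K :=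
  ofMat (Matrix.of fun r s => ρ fun i => mat (g i) r s)

/-- The hypothesis `hρ` is all that is needed of an ultrapower: `ρ` identifies families exactly when
they agree almost everywhere. A zero on the diagonal would therefore already occur for some index.
-/
theorem mat_ultraT (hρ : ∀ a b, ρ a = ρ b ↔ ∀ᶠ i in U, a i = b i) (g : I → T n F)
    (r s : Fin n) : mat (ultraT ρ g) r s = ρ fun i => mat (g i) r s := by
  rw [ultraT, mat_ofMat]
  · rfl
  · intro r s h
    rw [Matrix.of_apply, ← map_zero ρ, hρ]
    exact Eventually.of_forall fun i => mat_upper _ h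
  · intro r h
    rw [Matrix.of_apply, ← map_zero ρ, hρ] at h
    obtain ⟨i, hi⟩ := h.exists
    exact mat_diag_ne_zero _ _ hi

theorem ultraT_mul (hρ : ∀ a b, ρ a = ρ b ↔ ∀ᶠ i in U, a i = b i) (g h : I → T n F) :
    ultraT ρ (fun i => g i * h i) = ultraT ρ g * ultraT ρ h := by
  apply mat_injective
  ext r s
  rw [mat_mul, Matrix.mul_apply]
  simp only [mat_ultraT hρ, mat_mul, Matrix.mul_apply, ← map_mul, ← map_sum]
  congr 1
  ext i
  simp

theorem ultraT_one (hρ : ∀ a b, ρ a = ρ b ↔ ∀ᶠ i in U, a i = b i) :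
    ultraT ρ (fun _ => (1 : T n F)) = 1 := by
  have h := ultraT_mul hρ (fun _ => (1 : T n F)) (fun _ => 1)
  simpa using h

theorem ultraT_inv (hρ : ∀ a b, ρ a = ρ b ↔ ∀ᶠ i in U, a i = b i) (g : I → T n F) :
    ultraT ρ (fun i => (g i)⁻¹) = (ultraT ρ g)⁻¹ := by
  apply eq_inv_of_mul_eq_one_left
  rw [← ultraT_mul hρ]
  simpa using ultraT_one hρ

theorem ultraT_eq_iff (hρ : ∀ a b, ρ a = ρ b ↔ ∀ᶠ i in U, a i = b i) (g h : I → T n F) :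
    ultraT ρ g = ultraT ρ h ↔ ∀ᶠ i in U, g i = h i := by
  constructor
  · intro H
    have : ∀ r s, ∀ᶠ i in U, mat (g i) r s = mat (h i) r s := by
      intro r s
      rw [← hρ, ← mat_ultraT hρ, ← mat_ultraT hρ, H]
    filter_upwards [eventually_all.2 fun r => eventually_all.2 (this r)] with i hi
    exact mat_injective (Matrix.ext hi)
  · intro H
    apply mat_injective
    ext r s
    rw [mat_ultraT hρ, mat_ultraT hρ, hρ]
    exact H.mono fun i hi => by rw [hi]

theorem ultraT_surjective (hρ : ∀ a b, ρ a = ρ b ↔ ∀ᶠ i in U, a i = b i)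
    (hs : Function.Surjective ρ) (X : T n K) : ∃ g, ultraT ρ g = X := by
  choose x hx using fun r s => hs (mat X r s)
  -- The lifted entries form an invertible triangular matrix only for almost all `i`; elsewhere
  -- `ofMat` takes its default value, which does not affect the class.
  refine ⟨fun i => ofMat (Matrix.of fun r s => x r s i), ?_⟩
  have h1 : ∀ᶠ i in U, ∀ r s, s < r → x r s i = 0 := by
    refine eventually_all.2 fun r => eventually_all.2 fun s => ?_
    by_cases hrs : s < r
    · have : mat X r s = 0 := mat_upper X hrs
      rw [← hx, ← map_zero ρ, hρ] at this
      exact this.mono fun i hi _ => hi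
    · exact Eventually.of_forall fun i hi => absurd hi hrs
  have h2 : ∀ᶠ i in U, ∀ r, x r r i ≠ 0 := by
    refine eventually_all.2 fun r => Ultrafilter.eventually_not.2 fun h => ?_
    refine mat_diag_ne_zero X r ?_
    rw [← hx, ← map_zero ρ, hρ]
    exact h
  apply mat_injective
  ext r s
  rw [mat_ultraT hρ, ← hx, hρ]
  filter_upwards [h1, h2] with i hi hi'
  rw [mat_ofMat (M := Matrix.of fun r s => x r s i) (fun r s h => hi r s h) hi']
  rfl

attribute [local instance] groupStructure

/-- The ultrapower of `T n F` is `T n` of the ultrapower of `F`. -/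
theorem exists_product_equiv_T (hρ : ∀ a b, ρ a = ρ b ↔ ∀ᶠ i in U, a i = b i)
    (hs : Function.Surjective ρ) :
    ∃ e : ((U : Filter I).Product fun _ => T n F) ≃[groupLanguage] T n K,
      ∀ g : I → T n F, e (Quotient.mk _ g) = ultraT ρ g := by
  let e : ((U : Filter I).Product fun _ => T n F) ≃ T n K :=
    Equiv.ofBijective (Quotient.lift (ultraT ρ) fun g h H => (ultraT_eq_iff hρ g h).2 H) (by
      constructor
      · intro a b
        induction a, b using Quotient.inductionOn₂ with
        | h a b => exact fun h => Quotient.sound ((ultraT_eq_iff hρ a b).1 h)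
      · intro X
        obtain ⟨g, hg⟩ := ultraT_surjective hρ hs X
        exact ⟨Quotient.mk _ g, hg⟩)
  refine ⟨{ e with map_fun' := ?_, map_rel' := fun R => nomatch R }, fun g => rfl⟩
  intro k f x
  obtain ⟨y, hy⟩ : ∃ y : Fin k → I → T n F, ∀ i, Quotient.mk _ (y i) = x i :=
    ⟨_, fun i => (Quotient.exists_rep (x i)).choose_spec⟩
  obtain rfl : (fun i => Quotient.mk _ (y i)) = x := funext hy
  refine (congrArg e (Ultraproduct.funMap_cast (u := U) (M := fun _ => T n F) f y)).trans ?_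
  cases f with
  | mul => exact ultraT_mul hρ (y 0) (y 1)
  | inv => exact ultraT_inv hρ (y 0)
  | one => exact ultraT_one hρ

/-- A group elementarily equivalent to `T n F` embeds elementarily into `T n K` for an
ultrapower `K` of `F`, in which `T n F` is elementary as well. -/
theorem exists_elementaryEmbedding_T {F : Type u} [Field F] {H : Type v} [Group H]
    (hH : GroupElemEquiv H (T n F)) :
    ∃ (K : Type (max u v)) (_ : Field K) (κ : F →+* K) (_ : H ↪ₑ[groupLanguage] T n K)
      (δ : T n F ↪ₑ[groupLanguage] T n K), ∀ g r s, mat (δ g) r s = κ (mat g r s) := by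
  obtain ⟨I, U, ⟨f⟩⟩ := exists_elementaryEmbedding_ultrapower hH
  have hρ : ∀ a b, Germ.coeRingHom (R := F) (U : Filter I) a = Germ.coeRingHom (U : Filter I) b ↔
      ∀ᶠ i in U, a i = b i := fun a b => Germ.coe_eq
  have hs : Function.Surjective (Germ.coeRingHom (R := F) (U : Filter I)) :=
    fun x => Quotient.exists_rep x
  obtain ⟨e, he⟩ := exists_product_equiv_T (n := n) hρ hs
  refine ⟨(U : Filter I).Germ F, inferInstance,
    (Germ.coeRingHom (U : Filter I)).comp (Pi.constRingHom I F),
    e.toElementaryEmbedding.comp f,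
    e.toElementaryEmbedding.comp (diagonalEmbedding groupLanguage U (T n F)), fun g r s => ?_⟩
  refine (congrFun₂ (congrArg mat (he fun _ => g)) r s).trans ?_
  rw [mat_ultraT hρ]
  rfl

end Ultrapower

/-! ### Diagonal matrices and transvections -/

section Triangular

variable {n : ℕ} {K : Type*} [Field K]

theorem mem_UT {u : T n K} : u ∈ UT n K ↔ ∀ i, mat u i i = 1 := Iff.rfl

/-- `g` is a diagonal matrix. -/
def IsDiagT (g : T n K) : Prop := ∀ i j, i ≠ j → mat g i j = 0

theorem IsDiagT.mat_eq {g : T n K} (h : IsDiagT g) :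
    mat g = Matrix.diagonal fun i => mat g i i := by
  ext i j
  by_cases hij : i = j
  · subst hij; simp
  · rw [h i j hij, Matrix.diagonal_apply_ne _ hij]

/-- The diagonal matrix with given units on the diagonal. -/
noncomputable def dg (x : Fin n → Kˣ) : T n K := ofMat (Matrix.diagonal fun i => (x i : K))

theorem mat_dg (x : Fin n → Kˣ) : mat (dg x) = Matrix.diagonal fun i => (x i : K) :=
  mat_ofMat (fun i j h => Matrix.diagonal_apply_ne _ h.ne') fun i => by simp

theorem isDiagT_dg (x : Fin n → Kˣ) : IsDiagT (dg x) := fun i j h => by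
  rw [mat_dg, Matrix.diagonal_apply_ne _ h]

theorem mat_dg_diag (x : Fin n → Kˣ) (i : Fin n) : mat (dg x) i i = x i := by simp [mat_dg]

/-- The units on the diagonal. -/
noncomputable def diagUnits (g : T n K) (i : Fin n) : Kˣ := Units.mk0 _ (mat_diag_ne_zero g i)

theorem IsDiagT.mul {g h : T n K} (hg : IsDiagT g) (hh : IsDiagT h) : IsDiagT (g * h) := by
  intro i j hij
  rw [mat_mul, hg.mat_eq, hh.mat_eq, Matrix.diagonal_mul_diagonal, Matrix.diagonal_apply_ne _ hij]

theorem IsDiagT.inv {g : T n K} (hg : IsDiagT g) : IsDiagT g⁻¹ := by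
  have h1 : g * dg (fun i => (diagUnits g i)⁻¹) = 1 := by
    apply mat_injective
    rw [mat_mul, hg.mat_eq, mat_dg, Matrix.diagonal_mul_diagonal, mat_one, ← Matrix.diagonal_one]
    congr 1
    ext i
    exact (diagUnits g i).mul_inv
  rw [inv_eq_of_mul_eq_one_right h1]
  exact isDiagT_dg _

theorem IsDiagT.comm {g h : T n K} (hg : IsDiagT g) (hh : IsDiagT h) : g * h = h * g := by
  apply mat_injective
  rw [mat_mul, mat_mul, hg.mat_eq, hh.mat_eq, Matrix.diagonal_mul_diagonal,
    Matrix.diagonal_mul_diagonal]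
  simp only [mul_comm]

theorem IsDiagT.mul_apply {g : T n K} (hg : IsDiagT g) (h : T n K) (i j : Fin n) :
    mat (g * h) i j = mat g i i * mat h i j := by
  rw [mat_mul, hg.mat_eq, Matrix.diagonal_mul]
  simp

theorem IsDiagT.apply_mul {g : T n K} (hg : IsDiagT g) (h : T n K) (i j : Fin n) :
    mat (h * g) i j = mat h i j * mat g j j := by
  rw [mat_mul, hg.mat_eq, Matrix.mul_diagonal]
  simp

/-- The diagonal of `g` has distinct entries. -/
def IsRegularT (g : T n K) : Prop := Function.Injective fun i => mat g i i

theorem IsDiagT.isDiagT_of_comm {d g : T n K} (hd : IsDiagT d) (hr : IsRegularT d)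
    (h : g * d = d * g) : IsDiagT g := by
  intro i j hij
  have h1 := congrFun₂ (congrArg mat h) i j
  rw [hd.mul_apply, hd.apply_mul, mul_comm] at h1
  by_contra hne
  exact hij (hr (mul_right_cancel₀ hne h1)).symm

/-- Upper triangular matrices with the same regular diagonal are conjugate under `UT n K`. -/
theorem exists_conj_of_diag_eq {d d' : T n K} (hr : IsRegularT d)
    (h : ∀ i, mat d i i = mat d' i i) : ∃ v ∈ UT n K, v * d = d' * v := by
  -- With `v = 1 + X` and `X` strictly upper triangular, the equation `v d = d' v` becomes the
  -- linear equation `X d - d' X = d' - d`. On the finite-dimensional space of such `X` it suffices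
  -- to show that the left side is injective.
  let S : Submodule K (Matrix (Fin n) (Fin n) K) :=
    { carrier := {X | ∀ i j, j ≤ i → X i j = 0}
      add_mem' := fun {X Y} hX hY i j hij => by simp [hX i j hij, hY i j hij]
      zero_mem' := fun i j _ => rfl
      smul_mem' := fun c X hX i j hij => by simp [hX i j hij] }
  have hmul : ∀ X ∈ S, ∀ g : T n K, X * mat g ∈ S ∧ mat g * X ∈ S := by
    intro X hX g
    constructor
    · intro i j hij
      rw [Matrix.mul_apply]
      refine Finset.sum_eq_zero fun k _ => ?_
      rcases le_or_gt k i with hk | hk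
      · rw [hX i k hk, zero_mul]
      · rw [mat_upper g (hij.trans_lt hk), mul_zero]
    · intro i j hij
      rw [Matrix.mul_apply]
      refine Finset.sum_eq_zero fun k _ => ?_
      rcases le_or_gt i k with hk | hk
      · rw [hX k j (hij.trans hk), mul_zero]
      · rw [mat_upper g hk, zero_mul]
  let φ : S →ₗ[K] S :=
    { toFun := fun X => ⟨X.1 * mat d - mat d' * X.1,
        S.sub_mem (hmul X.1 X.2 d).1 (hmul X.1 X.2 d').2⟩
      map_add' := fun X Y => Subtype.ext (by simp [add_mul, mul_add]; abel)
      map_smul' := fun c X => Subtype.ext (by simp [smul_sub]) }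
  have hinj : Function.Injective φ := by
    rw [injective_iff_map_eq_zero]
    rintro ⟨X, hX⟩ hφ
    have hφ' : X * mat d = mat d' * X := sub_eq_zero.1 (congrArg Subtype.val hφ)
    -- Induction on superdiagonals: once the lower ones vanish, the `(i, j)` entry of the equation
    -- reads `X i j * d j j = d i i * X i j`.
    have key : ∀ m : ℕ, ∀ i j : Fin n, (j : ℕ) < i + m → X i j = 0 := by
      intro m
      induction m with
      | zero => exact fun i j hij => hX i j (Fin.le_def.2 (by omega))
      | succ m ih =>
        intro i j hij
        have h1 := congrFun₂ hφ' i j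
        rw [Matrix.mul_apply, Matrix.mul_apply, Finset.sum_eq_single j, Finset.sum_eq_single i,
          ← h, mul_comm] at h1
        · by_contra hne
          have hji : j = i := hr (mul_right_cancel₀ hne h1)
          exact hne (hX i j hji.le)
        · intro k _ hk
          rcases lt_or_gt_of_ne hk with hk | hk
          · rw [mat_upper d' hk, zero_mul]
          · rw [ih k j (by have := Fin.lt_def.1 hk; omega), mul_zero]
        · simp
        · intro k _ hk
          rcases lt_or_gt_of_ne hk with hk | hk
          · rw [ih i k (by have := Fin.lt_def.1 hk; omega), zero_mul]
          · rw [mat_upper d hk, mul_zero]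
        · simp
    apply Subtype.ext
    ext i j
    exact key n i j (by omega)
  have hDS : mat d' - mat d ∈ S := by
    intro i j hij
    rw [Matrix.sub_apply]
    rcases hij.lt_or_eq with hij | rfl
    · rw [mat_upper _ hij, mat_upper _ hij, sub_zero]
    · rw [h, sub_self]
  obtain ⟨X, hX⟩ := (LinearMap.injective_iff_surjective.1 hinj) ⟨_, hDS⟩
  have hX' : X.1 * mat d - mat d' * X.1 = mat d' - mat d := congrArg Subtype.val hX
  have hd1 : ∀ i, (1 + X.1) i i = 1 := fun i => by simp [X.2 i i le_rfl]
  have hv : mat (ofMat (1 + X.1)) = 1 + X.1 := by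
    refine mat_ofMat (fun i j hij => ?_) fun i => by rw [hd1]; exact one_ne_zero
    rw [Matrix.add_apply, X.2 i j hij.le, Matrix.one_apply_ne hij.ne', add_zero]
  refine ⟨ofMat (1 + X.1), fun i => ?_, mat_injective ?_⟩
  · change mat _ i i = 1
    rw [hv, hd1]
  · rw [mat_mul, mat_mul, hv, add_mul, mul_add, one_mul, mul_one]
    rw [sub_eq_sub_iff_add_eq_add] at hX'
    rw [add_comm, hX']

variable (n K) in
theorem exists_regular [Infinite K] : ∃ x : Fin n → Kˣ, Function.Injective x :=
  have : Infinite Kˣ := by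
    have : Infinite {a : K // a ≠ 0} := (Set.finite_singleton (0 : K)).infinite_compl.to_subtype
    exact unitsEquivNeZero.infinite_iff.2 this
  ⟨fun i => Infinite.natEmbedding Kˣ i,
    fun i j h => Fin.ext ((Infinite.natEmbedding Kˣ).injective h)⟩

theorem isRegularT_dg {x : Fin n → Kˣ} (hx : Function.Injective x) : IsRegularT (dg x) := by
  intro i j h
  simp only [mat_dg_diag] at h
  exact hx (Units.ext h)

/-- For a regular diagonal `t`, the matrices `t` and `u t` have the same diagonal and so are
conjugate, which writes `u` as a commutator. Every commutator is unitriangular because diagonals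
multiply. This makes `UT n K` definable without parameters. -/
theorem mem_UT_iff_commutator [Infinite K] {u : T n K} :
    u ∈ UT n K ↔ ∃ g h : T n K, u * (h * g) = g * h := by
  constructor
  · intro hu
    obtain ⟨x, hx⟩ := exists_regular n K
    obtain ⟨v, -, hv⟩ := exists_conj_of_diag_eq (d := dg x) (d' := u * dg x) (isRegularT_dg hx)
      fun i => by rw [mat_mul_diag, mem_UT.1 hu i, one_mul]
    exact ⟨v, dg x, by rw [hv, mul_assoc]⟩
  · rintro ⟨g, h, e⟩ i
    have h1 := congrFun₂ (congrArg mat e) i i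
    rw [mat_mul_diag, mat_mul_diag, mat_mul_diag, mul_comm (mat g i i)] at h1
    exact mul_right_cancel₀ (mul_ne_zero (mat_diag_ne_zero h i) (mat_diag_ne_zero g i))
      (h1.trans (one_mul _).symm)

/-- A triangular matrix with a repeated eigenvalue commutes with a nontrivial unitriangular one. -/
theorem isRegularT_of_centralizer {d : T n K} (h : ∀ u ∈ UT n K, u * d = d * u → u = 1) :
    IsRegularT d := by
  suffices key : ∀ i j : Fin n, i < j → mat d i i ≠ mat d j j by
    intro i j hij
    by_contra hne
    rcases lt_or_gt_of_ne hne with hlt | hlt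
    · exact key i j hlt hij
    · exact key j i hlt hij.symm
  intro i j hij heq
  -- A right eigenvector `v` supported on indices up to `i` and a left eigenvector `w` supported
  -- from `j` on, for the common eigenvalue, give the strictly upper triangular matrix `v wᵀ`, which
  -- commutes with `d`.
  obtain ⟨v, hv0, hv, hvs⟩ : ∃ v : Fin n → K, v ≠ 0 ∧
      (mat d).mulVec v = mat d i i • v ∧ ∀ k, i < k → v k = 0 := by
    -- Replacing the columns beyond `i` by those of the identity forces kernel vectors to vanish
    -- there, while the zero at `(i, i)` keeps the matrix singular.
    let M : Matrix (Fin n) (Fin n) K := Matrix.of fun a b =>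
      if b ≤ i then mat d a b - (if a = b then mat d i i else 0) else if a = b then 1 else 0
    have hMu : M.IsUpperTriangular := by
      intro a b hab
      have hab : b < a := hab
      simp [M, mat_upper d hab, hab.ne']
    have hdet : M.det = 0 := by
      rw [Matrix.det_of_isUpperTriangular hMu]
      exact Finset.prod_eq_zero (Finset.mem_univ i) (by simp [M])
    obtain ⟨v, hv0, hv⟩ := Matrix.exists_mulVec_eq_zero_iff.2 hdet
    have hvs : ∀ k, i < k → v k = 0 := by
      intro k hk
      have h1 := congrFun hv k
      rw [Matrix.mulVec, dotProduct, Finset.sum_eq_single k] at h1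
      · simpa [M, hk.not_ge] using h1
      · intro l _ hl
        by_cases hli : l ≤ i
        · simp [M, hli, mat_upper d (hli.trans_lt hk), hl.symm]
        · simp [M, hli, hl.symm]
      · simp
    refine ⟨v, hv0, ?_, hvs⟩
    ext a
    have h1 : ∑ b, M a b * v b = 0 := congrFun hv a
    have h2 : ∀ b, M a b * v b = mat d a b * v b - (if a = b then mat d i i * v b else 0) := by
      intro b
      rcases le_or_gt b i with hb | hb
      · simp only [M, Matrix.of_apply, hb, if_true, sub_mul, ite_mul, zero_mul]
      · simp [hvs b hb]
    simp only [h2, Finset.sum_sub_distrib, Finset.sum_ite_eq, Finset.mem_univ, if_true] at h1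
    exact sub_eq_zero.1 h1
  obtain ⟨w, hw0, hw, hws⟩ : ∃ w : Fin n → K, w ≠ 0 ∧
      Matrix.vecMul w (mat d) = mat d i i • w ∧ ∀ k, k < j → w k = 0 := by
    let M : Matrix (Fin n) (Fin n) K := Matrix.of fun a b =>
      if j ≤ a then mat d a b - (if a = b then mat d i i else 0) else if a = b then 1 else 0
    have hMu : M.IsUpperTriangular := by
      intro a b hab
      have hab : b < a := hab
      simp [M, mat_upper d hab, hab.ne']
    have hdet : M.det = 0 := by
      rw [Matrix.det_of_isUpperTriangular hMu]
      exact Finset.prod_eq_zero (Finset.mem_univ j) (by simp [M, heq])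
    obtain ⟨w, hw0, hw⟩ := Matrix.exists_vecMul_eq_zero_iff.2 hdet
    have hws : ∀ k, k < j → w k = 0 := by
      intro k hk
      have h1 := congrFun hw k
      rw [Matrix.vecMul, dotProduct, Finset.sum_eq_single k] at h1
      · simpa [M, hk.not_ge] using h1
      · intro l _ hl
        by_cases hlj : j ≤ l
        · simp [M, hlj, mat_upper d (hk.trans_le hlj), hl]
        · simp [M, hlj, hl]
      · simp
    refine ⟨w, hw0, ?_, hws⟩
    ext b
    have h1 : ∑ a, w a * M a b = 0 := congrFun hw b
    have h2 : ∀ a, w a * M a b = w a * mat d a b - (if a = b then mat d i i * w a else 0) := by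
      intro a
      rcases le_or_gt j a with ha | ha
      · simp only [M, Matrix.of_apply, ha, if_true, mul_sub, mul_ite, mul_zero, mul_comm]
      · simp [hws a ha]
    simp only [h2, Finset.sum_sub_distrib, Finset.sum_ite_eq', Finset.mem_univ, if_true] at h1
    exact sub_eq_zero.1 h1
  let N := Matrix.vecMulVec v w
  have hN : ∀ a b, b ≤ a → N a b = 0 := by
    intro a b hab
    change v a * w b = 0
    rcases lt_or_ge i a with hia | hia
    · rw [hvs a hia, zero_mul]
    · rw [hws b (hab.trans_lt (hia.trans_lt hij)), mul_zero]
  have hd1 : ∀ a, (1 + N) a a = 1 := fun a => by simp [hN a a le_rfl]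
  have hm : mat (ofMat (1 + N)) = 1 + N := by
    refine mat_ofMat (fun a b hab => ?_) fun a => by rw [hd1]; exact one_ne_zero
    rw [Matrix.add_apply, hN a b hab.le, Matrix.one_apply_ne hab.ne', add_zero]
  have h1 : ofMat (1 + N) = 1 := by
    refine h _ (fun a => ?_) (mat_injective ?_)
    · change mat _ a a = 1
      rw [hm, hd1]
    · rw [mat_mul, mat_mul, hm, add_mul, mul_add, Matrix.vecMulVec_mul, Matrix.mul_vecMulVec, hv,
        hw, one_mul, mul_one, Matrix.smul_vecMulVec, Matrix.vecMulVec_smul]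
  have h2 : N = 0 := by
    rw [← mat_inj, hm, mat_one] at h1
    simpa using h1
  obtain ⟨a, ha⟩ := Function.ne_iff.1 hv0
  obtain ⟨b, hb⟩ := Function.ne_iff.1 hw0
  exact mul_ne_zero ha hb (congrFun₂ h2 a b)

end Triangular

/-! ### Transvections, column matrices and their commutators -/

section Transvections

variable {n : ℕ} {K : Type*} [Field K]

/-- The matrix `1 + w eⱼᵀ`, for a vector `w` supported on the indices below `j`. -/
noncomputable def col (j : Fin n) (w : Fin n → K) : T n K :=
  ofMat (1 + Matrix.vecMulVec w (Pi.single j 1))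

/-- The transvection `1 + a Eᵢⱼ` for `i < j`. -/
noncomputable def tr (i j : Fin n) (a : K) : T n K := col j (Pi.single i a)

theorem mat_col {j : Fin n} {w : Fin n → K} (hw : ∀ k, j ≤ k → w k = 0) :
    mat (col j w) = 1 + Matrix.vecMulVec w (Pi.single j 1) := by
  refine mat_ofMat (fun a b hab => ?_) fun a => ?_
  · rw [Matrix.add_apply, Matrix.one_apply_ne hab.ne', Matrix.vecMulVec_apply, zero_add]
    by_cases hb : b = j
    · subst hb
      rw [hw a hab.le, zero_mul]
    · rw [Pi.single_eq_of_ne hb, mul_zero]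
  · rw [Matrix.add_apply, Matrix.one_apply_eq, Matrix.vecMulVec_apply]
    by_cases hb : a = j
    · subst hb
      simp [hw a le_rfl]
    · simp [Pi.single_eq_of_ne hb]

theorem col_apply {j : Fin n} {w : Fin n → K} (hw : ∀ k, j ≤ k → w k = 0) (a b : Fin n) :
    mat (col j w) a b = (if a = b then 1 else 0) + if b = j then w a else 0 := by
  rw [mat_col hw, Matrix.add_apply, Matrix.one_apply, Matrix.vecMulVec_apply, Pi.single_apply]
  simp

theorem col_mem_UT {j : Fin n} {w : Fin n → K} (hw : ∀ k, j ≤ k → w k = 0) :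
    col j w ∈ UT n K := by
  rw [mem_UT]
  intro i
  rw [col_apply hw, if_pos rfl]
  split_ifs with h
  · rw [hw i h.ge, add_zero]
  · rw [add_zero]

theorem vecMulVec_mul_of_zero {j : Fin n} {w w' : Fin n → K} (hw' : w' j = 0) :
    Matrix.vecMulVec w (Pi.single j 1) * Matrix.vecMulVec w' (Pi.single j 1) = 0 := by
  rw [Matrix.vecMulVec_mul_vecMulVec]
  simp [hw']

theorem col_add {j : Fin n} {w w' : Fin n → K} (hw : ∀ k, j ≤ k → w k = 0)
    (hw' : ∀ k, j ≤ k → w' k = 0) : col j (w + w') = col j w * col j w' := by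
  apply mat_injective
  rw [mat_mul, mat_col hw, mat_col hw', mat_col (fun k hk => by simp [hw k hk, hw' k hk]),
    mul_add, add_mul, add_mul, vecMulVec_mul_of_zero (hw' j le_rfl), Matrix.add_vecMulVec]
  simp [add_assoc]

theorem col_zero (j : Fin n) : col j (0 : Fin n → K) = 1 := by
  apply mat_injective
  rw [mat_col (w := 0) fun _ _ => rfl, mat_one]
  simp

theorem single_supp {i j : Fin n} (h : i < j) (a : K) (k : Fin n) (hk : j ≤ k) :
    (Pi.single i a : Fin n → K) k = 0 := Pi.single_eq_of_ne (h.trans_le hk).ne' _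

theorem tr_apply {i j : Fin n} (h : i < j) (a : K) (k l : Fin n) :
    mat (tr i j a) k l = (if k = l then 1 else 0) + if k = i ∧ l = j then a else 0 := by
  rw [tr, col_apply (single_supp h a), Pi.single_apply]
  by_cases h1 : k = i <;> by_cases h2 : l = j <;> simp [h1, h2]

theorem tr_apply_self {i j : Fin n} (h : i < j) (a : K) : mat (tr i j a) i j = a := by
  rw [tr_apply h, if_neg h.ne, if_pos ⟨rfl, rfl⟩, zero_add]

theorem tr_injective {i j : Fin n} (h : i < j) : Function.Injective (tr i j : K → T n K) := by
  intro a b hab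
  rw [← tr_apply_self h a, hab, tr_apply_self h]

theorem tr_mem_UT {i j : Fin n} (h : i < j) (a : K) : tr i j a ∈ UT n K :=
  col_mem_UT (single_supp h a)

theorem tr_add {i j : Fin n} (h : i < j) (a b : K) : tr i j (a + b) = tr i j a * tr i j b := by
  rw [tr, Pi.single_add, col_add (single_supp h a) (single_supp h b)]
  rfl

theorem tr_zero (i j : Fin n) : tr i j (0 : K) = 1 := by rw [tr, Pi.single_zero, col_zero]

theorem tr_neg {i j : Fin n} (h : i < j) (a : K) : tr i j (-a) = (tr i j a)⁻¹ := by
  apply eq_inv_of_mul_eq_one_left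
  rw [← tr_add h, neg_add_cancel, tr_zero]

theorem IsDiagT.mul_tr {g : T n K} (hg : IsDiagT g) {i j : Fin n} (h : i < j) (a : K) :
    g * tr i j a = tr i j (mat g i i * a / mat g j j) * g := by
  apply mat_injective
  ext k l
  rw [hg.mul_apply, hg.apply_mul, tr_apply h, tr_apply h]
  by_cases h2 : k = i ∧ l = j
  · obtain ⟨rfl, rfl⟩ := h2
    have := mat_diag_ne_zero g l
    simp only [h.ne, if_false, and_self, if_true, zero_add]
    field_simp
  · by_cases h1 : k = l
    · subst h1
      simp [h2]
    · simp [h1, h2]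

/-- Left multiplication by `tr i k a` and the columns beyond `k`. -/
theorem tr_mul_col {i k m : Fin n} (hik : i < k) (hkm : k < m) (a : K) {w : Fin n → K}
    (hw : ∀ k, m ≤ k → w k = 0) :
    tr i k a * col m w = tr i m (a * w k) * (col m w * tr i k a) := by
  have him := hik.trans hkm
  apply mat_injective
  rw [mat_mul, mat_mul, mat_mul, tr, tr, mat_col (single_supp hik a), mat_col hw,
    mat_col (single_supp him (a * w k))]
  simp only [mul_add, add_mul, one_mul, mul_one, Matrix.vecMulVec_mul_vecMulVec]
  have h1 : (Pi.single m (1 : K) : Fin n → K) ⬝ᵥ Pi.single i a = 0 := by simp [him.ne]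
  have h2 : (Pi.single k (1 : K) : Fin n → K) ⬝ᵥ w = w k := by simp
  have h3 : (Pi.single m (1 : K) : Fin n → K) ⬝ᵥ w = 0 := by simp [hw m le_rfl]
  have h4 : (w k • Pi.single i a : Fin n → K) = Pi.single i (a * w k) := by
    rw [← Pi.single_smul, smul_eq_mul, mul_comm]
  simp only [h1, h2, h3, zero_smul, Matrix.smul_vecMulVec, Matrix.vecMulVec_smul,
    Matrix.vecMulVec_zero, add_zero, ← h4]
  abel

theorem tr_mul_tr {i j k : Fin n} (hij : i < j) (hjk : j < k) (a b : K) :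
    tr i j a * tr j k b = tr i k (a * b) * (tr j k b * tr i j a) := by
  have := tr_mul_col hij hjk a (single_supp hjk b)
  rwa [Pi.single_eq_same] at this

/-- Conjugating a transvection into the last column by a unitriangular matrix. -/
theorem mul_tr_last {m : Fin n} (hm : ∀ k, k ≤ m) {u : T n K} (hu : u ∈ UT n K) {j : Fin n}
    (hj : j < m) : u * tr j m 1 = col m (fun k => mat u k j) * u := by
  apply mat_injective
  rw [mat_mul, mat_mul, tr, mat_col (single_supp hj 1), mat_col fun k hk =>
    mat_upper u (hj.trans_le hk), mul_add, add_mul, one_mul, mul_one, Matrix.mul_vecMulVec,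
    Matrix.vecMulVec_mul]
  -- The factor `1 + eⱼ eₘᵀ` changes under conjugation only in the vector `u eⱼ`, because the last
  -- row of a unitriangular matrix is `eₘᵀ`.
  congr 2
  · ext k
    simp
  · ext k
    rw [Matrix.single_one_vecMul]
    rcases (hm k).lt_or_eq with hk | rfl
    · rw [Pi.single_eq_of_ne hk.ne]
      exact (mat_upper u hk).symm
    · rw [Pi.single_eq_same]
      exact (hu k).symm

theorem eq_tr {u : T n K} (hu : u ∈ UT n K) {i j : Fin n} (hij : i < j)
    (h : ∀ k l, k < l → mat u k l ≠ 0 → k = i ∧ l = j) : u = tr i j (mat u i j) := by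
  apply mat_injective
  ext k l
  rw [tr_apply hij]
  rcases lt_trichotomy k l with hkl | rfl | hkl
  · by_cases hne : mat u k l = 0
    · rw [if_neg hkl.ne, zero_add]
      split_ifs with h'
      · rw [h'.1, h'.2]
      · exact hne
    · obtain ⟨rfl, rfl⟩ := h k l hkl hne
      simp [hkl.ne]
  · rw [mem_UT.1 hu k, if_pos rfl, if_neg (fun h' => hij.ne (h'.1.symm.trans h'.2)), add_zero]
  · rw [mat_upper u hkl, if_neg hkl.ne', if_neg, add_zero]
    rintro ⟨rfl, rfl⟩
    exact absurd hij hkl.not_gt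

/-- The transvections with a nonzero parameter in terms of the group and the diagonal matrices:
they are the nontrivial unitriangular elements in a single orbit `C \ {1}`, where `C` is the
centralizer in `UT n K` of a diagonal matrix. -/
theorem exists_eq_tr_iff [Infinite K] {u : T n K} :
    (u ∈ UT n K ∧ u ≠ 1 ∧ ∃ s, IsDiagT s ∧ s * u = u * s ∧
      ∀ u' ∈ UT n K, u' ≠ 1 → s * u' = u' * s → ∃ x, IsDiagT x ∧ u' * x = x * u) ↔
    ∃ i j, i < j ∧ ∃ c ≠ 0, u = tr i j c := by
  constructor
  · rintro ⟨hu, hu1, s, hs, hsu, H⟩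
    obtain ⟨i, j, hij, hne⟩ : ∃ i j, i < j ∧ mat u i j ≠ 0 := by
      by_contra! hcon
      refine hu1 (mat_injective (Matrix.ext fun i j => ?_))
      rw [mat_one]
      rcases lt_trichotomy i j with hij | rfl | hij
      · rw [hcon i j hij, Matrix.one_apply_ne hij.ne]
      · rw [mem_UT.1 hu i, Matrix.one_apply_eq]
      · rw [mat_upper u hij, Matrix.one_apply_ne hij.ne']
    have hs' : mat s i i = mat s j j := by
      have h1 := congrFun₂ (congrArg mat hsu) i j
      rw [hs.mul_apply, hs.apply_mul, mul_comm] at h1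
      exact mul_left_cancel₀ hne h1
    -- Commuting with `u` forces equal entries of `s` at `i` and `j`, so `tr i j 1` also centralizes
    -- `s`; by hypothesis it is then diagonally conjugate to `u`.
    obtain ⟨x, hx, hux⟩ := H (tr i j 1) (tr_mem_UT hij 1)
      (fun h => one_ne_zero (tr_injective (K := K) hij (h.trans (tr_zero i j).symm))) (by
        rw [hs.mul_tr hij, hs', mul_div_cancel_left₀ _ (mat_diag_ne_zero s j)])
    refine ⟨i, j, hij, mat x⁻¹ i i * 1 / mat x⁻¹ j j, ?_, ?_⟩
    · exact div_ne_zero (mul_ne_zero (mat_diag_ne_zero _ _) one_ne_zero) (mat_diag_ne_zero _ _)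
    · rw [← mul_left_inj x⁻¹, ← hx.inv.mul_tr hij, eq_inv_mul_iff_mul_eq, ← mul_assoc, ← hux,
        mul_inv_cancel_right]
  · rintro ⟨i, j, hij, c, hc, rfl⟩
    have hne : tr i j c ≠ 1 := fun h => hc (tr_injective hij (h.trans (tr_zero i j).symm))
    obtain ⟨x, hx⟩ := exists_regular n K
    -- The diagonal entries of `dg (x ∘ σ)` coincide at `i` and `j` and for no other pair, so its
    -- centralizer in `UT n K` is exactly one root subgroup.
    let σ : Fin n → Fin n := Function.update id j i
    have hσ : ∀ k l, k < l → σ k = σ l → k = i ∧ l = j := by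
      intro k l hkl h
      simp only [σ, Function.update_apply, id] at h
      split_ifs at h with h1 h2 h3
      · exact absurd (h1.trans h2.symm) hkl.ne
      · subst h1 h; exact absurd hkl hij.not_gt
      · exact ⟨h, h3⟩
      · exact absurd h hkl.ne
    refine ⟨tr_mem_UT hij c, hne, dg (x ∘ σ), isDiagT_dg _, ?_, fun u' hu' hne' hcomm => ?_⟩
    · have h1 : σ i = σ j := by simp [σ, hij.ne]
      rw [(isDiagT_dg _).mul_tr hij, mat_dg_diag, mat_dg_diag, Function.comp_apply,
        Function.comp_apply, h1, mul_div_cancel_left₀ _ (Units.ne_zero _)]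
    · have h1 : u' = tr i j (mat u' i j) := by
        refine eq_tr hu' hij fun k l hkl hne => hσ k l hkl (hx (Units.ext ?_))
        have h2 := congrFun₂ (congrArg mat hcomm) k l
        rw [(isDiagT_dg _).mul_apply, (isDiagT_dg _).apply_mul, mul_comm, mat_dg_diag,
          mat_dg_diag] at h2
        exact mul_left_cancel₀ hne h2
      have hc' : mat u' i j ≠ 0 := by
        intro h0
        rw [h0, tr_zero] at h1
        exact hne' h1
      refine ⟨dg (Function.update 1 i (Units.mk0 _ (div_ne_zero hc' hc))), isDiagT_dg _, ?_⟩
      rw [(isDiagT_dg _).mul_tr hij, mat_dg_diag, mat_dg_diag, Function.update_self,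
        Function.update_of_ne hij.ne']
      simp only [Units.val_mk0, Pi.one_apply, Units.val_one, div_one, div_mul_cancel₀ _ hc]
      rw [← h1]

end Transvections

/-! ### Unitriangular matrices over a subfield -/

section Subfield

variable {n : ℕ} {K : Type*} [Field K] {Γ : Subgroup (T n K)} {S : Subfield K}

theorem col_mem_of_entries (hS : ∀ i j, i < j → ∀ a, tr i j a ∈ Γ ↔ a ∈ S) {j : Fin n}
    {w : Fin n → K} (hw : ∀ k, j ≤ k → w k = 0) (h : ∀ k, w k ∈ S) : col j w ∈ Γ := by
  have key : ∀ s : Finset (Fin n), (∀ k, j ≤ k → (∑ l ∈ s, Pi.single l (w l) : Fin n → K) k = 0) ∧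
      col j (∑ l ∈ s, Pi.single l (w l)) ∈ Γ := by
    intro s
    induction s using Finset.induction_on with
    | empty => simp [col_zero, Γ.one_mem]
    | insert a s ha ih =>
      rw [Finset.sum_insert ha]
      rcases lt_or_ge a j with haj | haj
      · refine ⟨fun k hk => by rw [Pi.add_apply, ih.1 k hk, single_supp haj _ k hk, add_zero], ?_⟩
        rw [col_add (single_supp haj _) ih.1]
        exact Γ.mul_mem ((hS a j haj _).2 (h a)) ih.2
      · rw [hw a haj, Pi.single_zero, zero_add]
        exact ih
  have := (key Finset.univ).2
  rwa [Finset.univ_sum_single] at this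

/-- The commutator with `tr i k 1` isolates the entry at `k` as a transvection in `Γ`, provided some
`i < k` exists. The entry at the first index is what remains after dividing out the others. -/
theorem entries_mem_of_col (hS : ∀ i j, i < j → ∀ a, tr i j a ∈ Γ ↔ a ∈ S) {m : Fin n}
    {w : Fin n → K} (hw : ∀ k, m ≤ k → w k = 0) (h : col m w ∈ Γ) (k : Fin n) : w k ∈ S := by
  have h1 : ∀ i k, i < k → w k ∈ S := by
    intro i k hik
    rcases lt_or_ge k m with hkm | hkm
    · have h2 : tr i k 1 ∈ Γ := (hS i k hik 1).2 S.one_mem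
      have h3 := tr_mul_col hik hkm 1 hw
      rw [one_mul, ← mul_inv_eq_iff_eq_mul] at h3
      rw [← hS i m (hik.trans hkm), ← h3]
      exact Γ.mul_mem (Γ.mul_mem h2 h) (Γ.inv_mem (Γ.mul_mem h h2))
    · rw [hw k hkm]
      exact S.zero_mem
  by_cases hk : ∃ i, i < k
  · obtain ⟨i, hi⟩ := hk
    exact h1 i k hi
  push Not at hk
  rcases lt_or_ge k m with hkm | hkm
  · have hw' : ∀ l, m ≤ l → Function.update w k 0 l = 0 := fun l hl => by
      rw [Function.update_of_ne (hkm.trans_le hl).ne', hw l hl]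
    have hsum : w = Pi.single k (w k) + Function.update w k 0 := by
      ext l
      by_cases hl : l = k
      · subst hl; simp
      · simp [hl]
    have h2 : col m (Function.update w k 0) ∈ Γ := by
      refine col_mem_of_entries hS hw' fun l => ?_
      by_cases hl : l = k
      · subst hl; simp
      · rw [Function.update_of_ne hl]
        exact h1 k l (lt_of_le_of_ne (hk l) (Ne.symm hl))
    rw [hsum, col_add (single_supp hkm _) hw', Γ.mul_mem_cancel_right h2] at h
    exact (hS k m hkm _).1 h
  · rw [hw k hkm]
    exact S.zero_mem

/-- The matrix `u` with the columns from the `p`-th on replaced by those of the identity. -/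
noncomputable def trunc (u : T n K) (p : ℕ) : T n K :=
  ofMat (Matrix.of fun a b => if (b : ℕ) < p then mat u a b else if a = b then 1 else 0)

theorem trunc_apply {u : T n K} (hu : u ∈ UT n K) (p : ℕ) (a b : Fin n) :
    mat (trunc u p) a b = if (b : ℕ) < p then mat u a b else if a = b then 1 else 0 := by
  rw [trunc, mat_ofMat]
  · rfl
  · intro a b hab
    simp [mat_upper u hab, hab.ne']
  · intro a
    simp [mem_UT.1 hu a]

theorem trunc_succ {u : T n K} (hu : u ∈ UT n K) (j : Fin n) :
    trunc u (j + 1) = col j (fun k => if k < j then mat u k j else 0) * trunc u j := by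
  apply mat_injective
  rw [mat_mul, mat_col fun k hk => if_neg hk.not_gt, add_mul, one_mul, Matrix.vecMulVec_mul,
    Matrix.single_one_vecMul]
  ext a b
  rw [Matrix.add_apply, Matrix.vecMulVec_apply, trunc_apply hu, trunc_apply hu]
  have h1 : (mat (trunc u j)).row j b = mat (trunc u j) j b := rfl
  rw [h1, trunc_apply hu]
  rcases lt_trichotomy b j with hb | rfl | hb
  · have hb' := Fin.lt_def.1 hb
    simp [hb', Nat.lt_succ_of_lt hb', mat_upper u hb]
  · rcases lt_trichotomy a b with ha | rfl | ha
    · simp [ha, ha.ne]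
    · simp [mem_UT.1 hu a]
    · simp [mat_upper u ha, ha.not_gt, ha.ne']
  · have hb' := Fin.lt_def.1 hb
    simp [show ¬ (b : ℕ) < j + 1 by omega, show ¬ (b : ℕ) < j by omega, hb.ne]

theorem trunc_mem (hS : ∀ i j, i < j → ∀ a, tr i j a ∈ Γ ↔ a ∈ S) {u : T n K}
    (hu : u ∈ UT n K) {p : ℕ} (hp : p ≤ n) (h : ∀ i j : Fin n, (j : ℕ) < p → mat u i j ∈ S) :
    trunc u p ∈ Γ := by
  induction p with
  | zero =>
    have : trunc u 0 = 1 := mat_injective (Matrix.ext fun a b => by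
      rw [trunc_apply hu, mat_one, Matrix.one_apply]; simp)
    rw [this]
    exact Γ.one_mem
  | succ p ih =>
    rw [trunc_succ hu ⟨p, hp⟩]
    refine Γ.mul_mem (col_mem_of_entries hS (fun k hk => if_neg hk.not_gt) fun k => ?_)
      (ih (by omega) fun i j hj => h i j (by omega))
    split_ifs
    · exact h _ _ (Nat.lt_succ_self p)
    · exact S.zero_mem

theorem trunc_self {u : T n K} (hu : u ∈ UT n K) : trunc u n = u :=
  mat_injective (Matrix.ext fun a b => by rw [trunc_apply hu, if_pos b.2])

/-- If the transvections in `Γ` are those over the subfield `S`, then so are the unitriangular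
matrices. -/
theorem mem_iff_entries_mem (hS : ∀ i j, i < j → ∀ a, tr i j a ∈ Γ ↔ a ∈ S) {u : T n K}
    (hu : u ∈ UT n K) : u ∈ Γ ↔ ∀ i j, mat u i j ∈ S := by
  constructor
  · intro h i j
    have hn : 0 < n := j.pos
    let m : Fin n := ⟨n - 1, by omega⟩
    have hm : ∀ k : Fin n, k ≤ m := fun k => Fin.le_def.2 (by have := k.2; simp only [m]; omega)
    have h1 : ∀ i j : Fin n, (j : ℕ) < n - 1 → mat u i j ∈ S := by
      intro i j hj
      have hj' : j < m := hj
      -- Conjugating `tr j m 1` by `u` turns the column `j` of `u` into a column matrix in `Γ`,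
      -- whose entries are already known to lie in `S`.
      have h2 := mul_tr_last hm hu hj'
      rw [← mul_inv_eq_iff_eq_mul] at h2
      refine entries_mem_of_col hS (m := m) (w := fun k => mat u k j)
        (fun k hk => mat_upper u (hj'.trans_le hk)) ?_ i
      rw [← h2]
      exact Γ.mul_mem (Γ.mul_mem h ((hS j m hj' 1).2 S.one_mem)) (Γ.inv_mem h)
    rcases (hm j).lt_or_eq with hj | rfl
    · exact h1 i j hj
    -- The last column is not reached by this conjugation. The other columns have entries in `S`, so
    -- the truncation of `u` lies in `Γ` and can be divided out, leaving the last column alone.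
    · have h2 := trunc_mem hS hu (Nat.sub_le n 1) h1
      have h3 := trunc_succ hu m
      rw [show (m : ℕ) + 1 = n by simp only [m]; omega, trunc_self hu] at h3
      have h4 : col m (fun k => if k < m then mat u k m else 0) ∈ Γ := by
        rw [← Γ.mul_mem_cancel_right (show trunc u m ∈ Γ from h2), ← h3]
        exact h
      have h5 := entries_mem_of_col hS (fun k hk => if_neg hk.not_gt) h4 i
      rcases (hm i).lt_or_eq with hi | rfl
      · simpa [hi] using h5
      · rw [mem_UT.1 hu]
        exact S.one_mem
  · intro h
    rw [← trunc_self hu]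
    exact trunc_mem hS hu le_rfl fun i j _ => h i j

end Subfield

/-! ### Definable sets in groups -/

section GroupDefinability

open FirstOrder FirstOrder.Language

attribute [local instance] groupStructure

instance : groupLanguage.IsAlgebraic := fun _ => inferInstanceAs (IsEmpty Empty)

variable {M N : Type*} [Group N] {α : Type*}

theorem DefTerm.mul {f : M → N} {τ σ : (α → N) → N} (hτ : DefTerm groupLanguage f τ)
    (hσ : DefTerm groupLanguage f σ) : DefTerm groupLanguage f (fun v => τ v * σ v) :=
  DefTerm.func (L := groupLanguage) (f := f) (GroupFunc.mul : groupLanguage.Functions 2)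
    (τ := ![τ, σ]) fun i => by fin_cases i <;> assumption

theorem DefTerm.inv {f : M → N} {τ : (α → N) → N} (hτ : DefTerm groupLanguage f τ) :
    DefTerm groupLanguage f (fun v => (τ v)⁻¹) :=
  DefTerm.func (L := groupLanguage) (f := f) (GroupFunc.inv : groupLanguage.Functions 1)
    (τ := ![τ]) fun i => by fin_cases i; assumption

theorem DefTerm.one {f : M → N} : DefTerm groupLanguage f (fun _ : α → N => (1 : N)) :=
  DefTerm.func (L := groupLanguage) (f := f) (GroupFunc.one : groupLanguage.Functions 0)
    (τ := ![]) fun i => i.elim0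

variable [Group M]

/-- The group homomorphism underlying an elementary embedding. -/
def toMonoidHom (f : M ↪ₑ[groupLanguage] N) : M →* N :=
  MonoidHom.mk' f fun a b => f.map_fun (GroupFunc.mul : groupLanguage.Functions 2) ![a, b]

theorem toMonoidHom_apply (f : M ↪ₑ[groupLanguage] N) (a : M) : toMonoidHom f a = f a := rfl

/-- A group isomorphism as an isomorphism of structures. -/
def mulEquivToEquiv (e : M ≃* N) : M ≃[groupLanguage] N :=
  { e.toEquiv with
    map_fun' := fun {k} F x => by
      cases F with
      | mul => exact e.map_mul _ _
      | inv => exact e.map_inv _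
      | one => exact e.map_one
    map_rel' := fun R => nomatch R }

theorem GroupElemEquiv.of_mulEquiv (e : M ≃* N) : GroupElemEquiv M N :=
  (mulEquivToEquiv e).toElementaryEmbedding.elementarilyEquivalent

theorem GroupElemEquiv.symm (h : GroupElemEquiv M N) : GroupElemEquiv N M := Eq.symm h

theorem GroupElemEquiv.trans {P : Type*} [Group P] (h : GroupElemEquiv M N)
    (h' : GroupElemEquiv N P) : GroupElemEquiv M P := Eq.trans h h'

theorem FieldElemEquiv.symm {K L : Type*} [Field K] [Field L] (h : FieldElemEquiv K L) :
    FieldElemEquiv L K := Eq.symm h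

theorem FieldElemEquiv.trans {K L P : Type*} [Field K] [Field L] [Field P]
    (h : FieldElemEquiv K L) (h' : FieldElemEquiv L P) : FieldElemEquiv K P := Eq.trans h h'

theorem mem_center_iff_map (f : M ↪ₑ[groupLanguage] N) (z : M) :
    z ∈ Subgroup.center M ↔ f z ∈ Subgroup.center N := by
  rw [Subgroup.mem_center_iff, Subgroup.mem_center_iff]
  constructor
  · intro h
    by_contra! hne
    obtain ⟨m, hm⟩ := DefPred.exists_point_one f (P := fun g => ¬g * f z = f z * g)
      (DefPred.eq ((DefTerm.var ()).mul (DefTerm.param z))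
        ((DefTerm.param z).mul (DefTerm.var ()))).not hne
    refine hm ?_
    rw [← toMonoidHom_apply, ← toMonoidHom_apply, ← map_mul, h, map_mul]
  · intro h m
    apply f.injective
    have := h (f m)
    rwa [← toMonoidHom_apply, ← toMonoidHom_apply, ← map_mul, ← map_mul] at this

/-- An elementary embedding induces an elementary equivalence of the centers. -/
theorem center_groupElemEquiv (f : M ↪ₑ[groupLanguage] N) :
    GroupElemEquiv (Subgroup.center M) (Subgroup.center N) := by
  let κ : Subgroup.center M ↪[groupLanguage] Subgroup.center N :=
    { toFun := fun z => ⟨f z, (mem_center_iff_map f z).1 z.2⟩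
      inj' := fun a b h => Subtype.ext (f.injective (congrArg Subtype.val h))
      map_fun' := fun {k} F x => by
        cases F with
        | mul => exact Subtype.ext ((toMonoidHom f).map_mul _ _)
        | inv => exact Subtype.ext ((toMonoidHom f).map_inv _)
        | one => exact Subtype.ext ((toMonoidHom f).map_one)
      map_rel' := fun R => nomatch R }
  refine elementarilyEquivalent_of_coded (L := groupLanguage) (j := Subtype.val) f κ
    Subtype.val_injective ?_ (fun k F => ?_) fun a => ?_
  · refine (DefPred.forall_one (P := fun v g => g * v () = v () * g)
      (DefPred.eq (DefTerm.mul (DefTerm.var _) (DefTerm.var _))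
        (DefTerm.mul (DefTerm.var _) (DefTerm.var _)))).congr fun v => ?_
    rw [← Subgroup.mem_center_iff, Subtype.range_coe]
    rfl
  · cases F with
    | mul => exact ⟨_, DefPred.eq (DefTerm.var (Sum.inr ()))
        ((DefTerm.var (Sum.inl 0)).mul (DefTerm.var (Sum.inl 1))), fun a =>
        ⟨fun h => Subtype.ext h, fun h => congrArg Subtype.val h⟩⟩
    | inv => exact ⟨_, DefPred.eq (DefTerm.var (Sum.inr ()))
        (DefTerm.var (Sum.inl 0)).inv, fun a =>
        ⟨fun h => Subtype.ext h, fun h => congrArg Subtype.val h⟩⟩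
    | one => exact ⟨_, DefPred.eq (DefTerm.var (Sum.inr ())) DefTerm.one, fun a =>
        ⟨fun h => Subtype.ext h, fun h => congrArg Subtype.val h⟩⟩
  · constructor
    · rintro ⟨m, hm⟩
      exact ⟨⟨m, (mem_center_iff_map f m).2 (hm ▸ a.2)⟩, Subtype.ext hm⟩
    · rintro ⟨z, rfl⟩
      exact ⟨z, rfl⟩

end GroupDefinability

/-! ### Elementary subgroups of `T n K` -/

section Frame

open FirstOrder FirstOrder.Language

attribute [local instance] groupStructure

variable {n : ℕ} {K : Type*} [Field K] {M : Type*} {α : Type*}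

theorem DefTerm.mem_UT [Infinite K] {f : M → T n K} {τ : (α → T n K) → T n K}
    (hτ : DefTerm groupLanguage f τ) : DefPred groupLanguage f (fun v => τ v ∈ UT n K) := by
  have h : DefPred groupLanguage f (fun v : Unit → T n K =>
      ∃ g : Bool → T n K, v () * (g true * g false) = g false * g true) :=
    DefPred.exists_tuple (DefPred.eq
      ((DefTerm.var (Sum.inl ())).mul ((DefTerm.var (Sum.inr true)).mul
        (DefTerm.var (Sum.inr false))))
      ((DefTerm.var (Sum.inr false)).mul (DefTerm.var (Sum.inr true))))
  refine (h.subst fun _ => hτ).congr fun v => ?_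
  rw [mem_UT_iff_commutator]
  exact ⟨fun ⟨g, hg⟩ => ⟨_, _, hg⟩, fun ⟨g, h, e⟩ => ⟨fun b => bif b then h else g, e⟩⟩

theorem DefTerm.isDiagT {f : M → T n K} {d : M} (hd : IsDiagT (f d)) (hr : IsRegularT (f d))
    {τ : (α → T n K) → T n K} (hτ : DefTerm groupLanguage f τ) :
    DefPred groupLanguage f (fun v => IsDiagT (τ v)) :=
  (DefPred.eq (hτ.mul (DefTerm.param d)) ((DefTerm.param d).mul hτ)).congr fun _ =>
    ⟨hd.isDiagT_of_comm hr, fun h => h.comm hd⟩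

theorem DefTerm.diag_conj {f : M → T n K} {d : M} (hd : IsDiagT (f d)) (hr : IsRegularT (f d))
    {τ σ : (α → T n K) → T n K} (hτ : DefTerm groupLanguage f τ)
    (hσ : DefTerm groupLanguage f σ) :
    DefPred groupLanguage f (fun v => ∃ x, IsDiagT x ∧ τ v * x = x * σ v) := by
  have h : DefPred groupLanguage f (fun v : Bool → T n K =>
      ∃ x, IsDiagT x ∧ v true * x = x * v false) :=
    DefPred.exists_one (P := fun v x => IsDiagT x ∧ v true * x = x * v false)
      ((DefTerm.isDiagT hd hr (DefTerm.var _)).and (DefPred.eq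
        (DefTerm.mul (DefTerm.var _) (DefTerm.var _))
        (DefTerm.mul (DefTerm.var _) (DefTerm.var _))))
  exact h.subst (τ := fun b => bif b then τ else σ) (fun b => by cases b <;> assumption)

variable [Group M]

/-- Having trivial centralizer in `UT n K` is a definable condition which implies regularity and
which a regular diagonal matrix satisfies, so it has a solution in the image. -/
theorem exists_isRegularT [Infinite K] (f : M ↪ₑ[groupLanguage] T n K) :
    ∃ d, IsRegularT (f d) := by
  have h : DefPred groupLanguage f (fun v : Unit → T n K =>
      ∀ u, u ∈ UT n K → u * v () = v () * u → u = 1) := by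
    refine DefPred.forall_one (P := fun v u => u ∈ UT n K → u * v () = v () * u → u = 1) ?_
    exact (DefTerm.mem_UT (DefTerm.var _)).imp ((DefPred.eq
      (DefTerm.mul (DefTerm.var _) (DefTerm.var _))
      (DefTerm.mul (DefTerm.var _) (DefTerm.var _))).imp
      (DefPred.eq (DefTerm.var _) DefTerm.one))
  obtain ⟨x, hx⟩ := exists_regular n K
  obtain ⟨d, hd⟩ := DefPred.exists_point_one f
    (P := fun g => ∀ u, u ∈ UT n K → u * g = g * u → u = 1) h
    ⟨dg x, fun u hu huc => by
      have h1 := (isDiagT_dg x).isDiagT_of_comm (isRegularT_dg hx) huc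
      refine mat_injective (Matrix.ext fun i j => ?_)
      rw [mat_one]
      by_cases hij : i = j
      · subst hij
        rw [AbelianDeformation.mem_UT.1 hu, Matrix.one_apply_eq]
      · rw [h1 i j hij, Matrix.one_apply_ne hij]⟩
  exact ⟨d, isRegularT_of_centralizer hd⟩

/-- The embedding `f` followed by conjugation with `g`. -/
noncomputable def conjEmb (g : T n K) (f : M ↪ₑ[groupLanguage] T n K) :
    M ↪ₑ[groupLanguage] T n K :=
  (mulEquivToEquiv (MulAut.conj g)).toElementaryEmbedding.comp f

theorem conjEmb_apply (g : T n K) (f : M ↪ₑ[groupLanguage] T n K) (m : M) :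
    conjEmb g f m = g * f m * g⁻¹ := rfl

theorem exists_isDiagT [Infinite K] (f : M ↪ₑ[groupLanguage] T n K) :
    ∃ (f' : M ↪ₑ[groupLanguage] T n K) (d : M), IsDiagT (f' d) ∧ IsRegularT (f' d) := by
  obtain ⟨d, hd⟩ := exists_isRegularT f
  obtain ⟨v, -, hv⟩ := exists_conj_of_diag_eq (d := f d) (d' := dg (diagUnits (f d))) hd
    fun i => (mat_dg_diag (diagUnits (f d)) i).symm
  have h : conjEmb v f d = dg (diagUnits (f d)) := by
    rw [conjEmb_apply, hv, mul_inv_cancel_right]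
  refine ⟨conjEmb v f, d, h ▸ isDiagT_dg _, fun i j hij => hd ?_⟩
  simp only [h, mat_dg_diag] at hij
  exact hij

/-- Diagonal conjugation scales the parameter by an arbitrary unit, so one nontrivial element of a
root subgroup is enough to define the whole subgroup. -/
theorem exists_diag_conj_tr {i j : Fin n} (hij : i < j) {c : K} (hc : c ≠ 0) {y : T n K} :
    (∃ x, IsDiagT x ∧ y * x = x * tr i j c) ↔ ∃ c' ≠ 0, y = tr i j c' := by
  constructor
  · rintro ⟨x, hx, h⟩
    rw [hx.mul_tr hij, mul_left_inj] at h
    exact ⟨_, div_ne_zero (mul_ne_zero (mat_diag_ne_zero _ _) hc) (mat_diag_ne_zero _ _), h⟩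
  · rintro ⟨c', hc', rfl⟩
    refine ⟨dg (Function.update 1 i (Units.mk0 _ (div_ne_zero hc' hc))), isDiagT_dg _, ?_⟩
    rw [(isDiagT_dg _).mul_tr hij, mat_dg_diag, mat_dg_diag, Function.update_self,
      Function.update_of_ne hij.ne']
    simp [div_mul_cancel₀ _ hc]

/-- Every root subgroup contains a nontrivial element of an elementary subgroup that has a regular
diagonal element. -/
theorem exists_eq_tr [Infinite K] (f : M ↪ₑ[groupLanguage] T n K) {d : M} (hd : IsDiagT (f d))
    (hr : IsRegularT (f d)) {i j : Fin n} (hij : i < j) : ∃ m, ∃ c ≠ 0, f m = tr i j c := by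
  by_contra hno
  -- These are the roots already represented. Being a transvection outside their finitely many
  -- diagonal conjugacy classes is definable and holds for `tr i j 1`; a solution from `M` would
  -- represent a root not in `I`, which is absurd.
  let I := {p : Fin n × Fin n // p.1 < p.2 ∧ ∃ m, ∃ c ≠ 0, f m = tr p.1 p.2 c}
  choose m c hc hm using fun p : I => p.2.2
  have h1 : DefPred groupLanguage f (fun v : Unit → T n K => v () ∈ UT n K ∧ v () ≠ 1 ∧
      ∃ s, IsDiagT s ∧ s * v () = v () * s ∧ ∀ u', u' ∈ UT n K → u' ≠ 1 → s * u' = u' * s →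
        ∃ x, IsDiagT x ∧ u' * x = x * v ()) := by
    refine (DefTerm.mem_UT (DefTerm.var _)).and ((DefPred.eq (DefTerm.var _) DefTerm.one).not.and ?_)
    refine DefPred.exists_one (P := fun v s => IsDiagT s ∧ s * v () = v () * s ∧ ∀ u',
      u' ∈ UT n K → u' ≠ 1 → s * u' = u' * s → ∃ x, IsDiagT x ∧ u' * x = x * v ()) ?_
    refine (DefTerm.isDiagT hd hr (DefTerm.var _)).and ((DefPred.eq
      (DefTerm.mul (DefTerm.var _) (DefTerm.var _))
      (DefTerm.mul (DefTerm.var _) (DefTerm.var _))).and ?_)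
    refine DefPred.forall_one (α := Unit ⊕ Unit) (P := fun v u' =>
      u' ∈ UT n K → u' ≠ 1 → v (.inr ()) * u' = u' * v (.inr ()) →
        ∃ x, IsDiagT x ∧ u' * x = x * v (.inl ())) ?_
    exact (DefTerm.mem_UT (DefTerm.var _)).imp ((DefPred.eq (DefTerm.var _) DefTerm.one).not.imp
      ((DefPred.eq (DefTerm.mul (DefTerm.var _) (DefTerm.var _))
      (DefTerm.mul (DefTerm.var _) (DefTerm.var _))).imp
        (DefTerm.diag_conj hd hr (DefTerm.var _) (DefTerm.var _))))
  have h2 : DefPred groupLanguage f (fun v : Unit → T n K =>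
      ∀ p : I, ¬∃ x, IsDiagT x ∧ v () * x = x * f (m p)) :=
    DefPred.forall_finite fun p => (DefTerm.diag_conj hd hr (DefTerm.var _) (DefTerm.param _)).not
  obtain ⟨m₀, hm₀, hm₀'⟩ := DefPred.exists_point_one f (P := fun u => (u ∈ UT n K ∧ u ≠ 1 ∧
      ∃ s, IsDiagT s ∧ s * u = u * s ∧ ∀ u', u' ∈ UT n K → u' ≠ 1 → s * u' = u' * s →
        ∃ x, IsDiagT x ∧ u' * x = x * u) ∧ ∀ p : I, ¬∃ x, IsDiagT x ∧ u * x = x * f (m p))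
    (h1.and h2) ⟨tr i j 1, exists_eq_tr_iff.2 ⟨i, j, hij, 1, one_ne_zero, rfl⟩, fun p hp => by
      rw [hm, exists_diag_conj_tr p.2.1 (hc p)] at hp
      obtain ⟨c', hc', h⟩ := hp
      have h3 := tr_apply_self hij (1 : K)
      rw [h, tr_apply p.2.1, if_neg hij.ne, zero_add] at h3
      split_ifs at h3 with h4
      · refine hno ?_
        rw [h4.1, h4.2]
        exact p.2.2
      · exact zero_ne_one h3⟩
  obtain ⟨k, l, hkl, c', hc', h⟩ := exists_eq_tr_iff.1 hm₀
  refine hm₀' ⟨(k, l), hkl, m₀, c', hc', h⟩ ?_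
  rw [hm, exists_diag_conj_tr hkl (hc _)]
  exact ⟨c', hc', h⟩

/-- The elementary subgroup contains a regular diagonal element and the transvections with
parameter `1`. -/
structure IsFrame (f : M ↪ₑ[groupLanguage] T n K) : Prop where
  diag : ∃ d, IsDiagT (f d) ∧ IsRegularT (f d)
  tr : ∀ i j, i < j → ∃ m, f m = tr i j 1

/-- The range of an elementary embedding, as a subgroup. -/
def rangeT (f : M ↪ₑ[groupLanguage] T n K) : Subgroup (T n K) := (toMonoidHom f).range

theorem mem_rangeT {f : M ↪ₑ[groupLanguage] T n K} {g : T n K} : g ∈ rangeT f ↔ ∃ m, f m = g :=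
  Iff.rfl

theorem apply_mem_rangeT (f : M ↪ₑ[groupLanguage] T n K) (m : M) : f m ∈ rangeT f := ⟨m, rfl⟩

theorem DefTerm.mem_tr {f : M ↪ₑ[groupLanguage] T n K} {d : M} (hd : IsDiagT (f d))
    (hr : IsRegularT (f d)) {i j : Fin n} (hij : i < j) {m : M} {c : K} (hc : c ≠ 0)
    (hm : f m = AbelianDeformation.tr i j c) {τ : (α → T n K) → T n K}
    (hτ : DefTerm groupLanguage f τ) :
    DefPred groupLanguage f (fun v => ∃ a, τ v = AbelianDeformation.tr i j a) := by
  refine ((DefPred.eq hτ DefTerm.one).or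
    (DefTerm.diag_conj hd hr hτ (DefTerm.param m))).congr fun v => ?_
  rw [hm, exists_diag_conj_tr hij hc]
  constructor
  · rintro (h | ⟨c', -, h⟩)
    · exact ⟨0, by rw [h, tr_zero]⟩
    · exact ⟨c', h⟩
  · rintro ⟨a, h⟩
    by_cases ha : a = 0
    · left
      rw [h, ha, tr_zero]
    · exact Or.inr ⟨a, ha, h⟩

/-- Division in the coordinate field: the left factor of a commutator of transvections. -/
theorem tr_left_mem {f : M ↪ₑ[groupLanguage] T n K} {d : M} (hd : IsDiagT (f d))
    (hr : IsRegularT (f d)) {i j k : Fin n} (hij : i < j) (hjk : j < k)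
    {m : M} {c₀ : K} (hc₀ : c₀ ≠ 0) (hm : f m = AbelianDeformation.tr i j c₀) {b c : K}
    (hb : b ≠ 0) (h : tr j k b ∈ rangeT f) (h' : tr i k c ∈ rangeT f) :
    tr i j (c / b) ∈ rangeT f := by
  obtain ⟨y, hy⟩ := h
  obtain ⟨z, hz⟩ := h'
  rw [toMonoidHom_apply] at hy hz
  obtain ⟨t, ⟨a, ha⟩, ht⟩ := DefPred.exists_point_one f
    (P := fun t => (∃ a, t = tr i j a) ∧ t * f y = f z * (f y * t))
    ((DefTerm.mem_tr hd hr hij hc₀ hm (DefTerm.var _)).and (DefPred.eq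
      (DefTerm.mul (DefTerm.var _) (DefTerm.param _))
      (DefTerm.mul (DefTerm.param _) (DefTerm.mul (DefTerm.param _) (DefTerm.var _)))))
    ⟨tr i j (c / b), ⟨_, rfl⟩, by rw [hy, hz, tr_mul_tr hij hjk, div_mul_cancel₀ _ hb]⟩
  rw [ha, hy, hz, tr_mul_tr hij hjk, mul_left_inj] at ht
  have := tr_injective (hij.trans hjk) ht
  rw [← this, mul_div_cancel_right₀ _ hb]
  exact ⟨t, ha⟩

/-- Division in the coordinate field: the right factor of a commutator of transvections. -/
theorem tr_right_mem {f : M ↪ₑ[groupLanguage] T n K} (hf : IsFrame f) {i j k : Fin n}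
    (hij : i < j) (hjk : j < k) {c : K} (h' : tr i k c ∈ rangeT f) : tr j k c ∈ rangeT f := by
  obtain ⟨d, hd, hr⟩ := hf.diag
  obtain ⟨y, hy⟩ := hf.tr i j hij
  obtain ⟨m, hm⟩ := hf.tr j k hjk
  obtain ⟨z, hz⟩ := h'
  rw [toMonoidHom_apply] at hz
  obtain ⟨t, ⟨a, ha⟩, ht⟩ := DefPred.exists_point_one f
    (P := fun t => (∃ a, t = tr j k a) ∧ f y * t = f z * (t * f y))
    ((DefTerm.mem_tr hd hr hjk one_ne_zero hm (DefTerm.var _)).and (DefPred.eq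
      (DefTerm.mul (DefTerm.param _) (DefTerm.var _))
      (DefTerm.mul (DefTerm.param _) (DefTerm.mul (DefTerm.var _) (DefTerm.param _)))))
    ⟨tr j k c, ⟨_, rfl⟩, by rw [hy, hz, tr_mul_tr hij hjk, one_mul]⟩
  rw [ha, hy, hz, tr_mul_tr hij hjk, mul_left_inj, one_mul] at ht
  rw [← tr_injective (hij.trans hjk) ht]
  exact ⟨t, ha⟩

theorem exists_isFrame [Infinite K] (f : M ↪ₑ[groupLanguage] T n K) :
    ∃ f' : M ↪ₑ[groupLanguage] T n K, IsFrame f' := by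
  obtain ⟨f, d, hd, hr⟩ := exists_isDiagT f
  rcases Nat.eq_zero_or_pos n with rfl | hn
  · exact ⟨f, ⟨d, hd, hr⟩, fun i => i.elim0⟩
  choose m c hc hm using fun i j (hij : i < j) => exists_eq_tr f hd hr hij
  let q : Fin n := ⟨n - 1, by omega⟩
  have hq : ∀ k : Fin n, k ≤ q := fun k => Fin.le_def.2 (by have := k.2; simp only [q]; omega)
  -- Conjugation by this matrix normalizes the parameters in the last column to 1 and fixes the
  -- diagonal element `f d`. For the other roots, `tr i j 1` is recovered from its commutator `tr i
  -- q 1` with `tr j q 1`.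
  let x : Fin n → Kˣ := fun i => if h : i < q then (Units.mk0 _ (hc i q h))⁻¹ else 1
  have hxd : conjEmb (dg x) f d = f d := by
    rw [conjEmb_apply, (isDiagT_dg x).comm hd, mul_inv_cancel_right]
  have hd' : IsDiagT (conjEmb (dg x) f d) := hxd ▸ hd
  have hr' : IsRegularT (conjEmb (dg x) f d) := hxd ▸ hr
  have hm' : ∀ i j (hij : i < j), conjEmb (dg x) f (m i j hij) =
      tr i j (x i * c i j hij / x j) := fun i j hij => by
    rw [conjEmb_apply, hm, (isDiagT_dg x).mul_tr hij, mul_inv_cancel_right, mat_dg_diag,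
      mat_dg_diag]
  have hq1 : ∀ i (hi : i < q), conjEmb (dg x) f (m i q hi) = tr i q 1 := by
    intro i hi
    rw [hm']
    simp [x, hi, hc]
  refine ⟨conjEmb (dg x) f, ⟨d, hd', hr'⟩, fun i j hij => ?_⟩
  rcases (hq j).lt_or_eq with hj | rfl
  · have h := tr_left_mem hd' hr' hij hj
      (div_ne_zero (mul_ne_zero (Units.ne_zero _) (hc i j hij)) (Units.ne_zero _)) (hm' i j hij)
      one_ne_zero (hq1 j hj ▸ apply_mem_rangeT _ _) (hq1 i (hij.trans hj) ▸ apply_mem_rangeT _ _)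
    rw [div_one] at h
    exact h
  · exact ⟨_, hq1 i hij⟩

end Frame

/-! ### The coordinate field of a framed elementary subgroup -/

section CoordinateField

open FirstOrder FirstOrder.Language

attribute [local instance] groupStructure

variable {n : ℕ} {K : Type*} [Field K] {M : Type*} [Group M]
  {f : M ↪ₑ[groupLanguage] T n K}

theorem tr_mul_mem {Γ : Subgroup (T n K)} {i j k : Fin n} (hij : i < j) (hjk : j < k) {a b : K}
    (ha : tr i j a ∈ Γ) (hb : tr j k b ∈ Γ) : tr i k (a * b) ∈ Γ := by
  have h := tr_mul_tr hij hjk a b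
  rw [← mul_inv_eq_iff_eq_mul] at h
  rw [← h]
  exact Γ.mul_mem (Γ.mul_mem ha hb) (Γ.inv_mem (Γ.mul_mem hb ha))

/-- The parameters of the transvections in a framed elementary subgroup form a subfield. -/
theorem IsFrame.exists_subfield (hf : IsFrame f) (hn : 3 ≤ n) :
    ∃ S : Subfield K, ∀ i j, i < j → ∀ a, AbelianDeformation.tr i j a ∈ rangeT f ↔ a ∈ S := by
  obtain ⟨d, hd, hr⟩ := hf.diag
  have hone : ∀ i j, i < j → AbelianDeformation.tr i j (1 : K) ∈ rangeT f := hf.tr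
  have hleft : ∀ {i j k : Fin n}, i < j → j < k → ∀ {b c : K}, b ≠ 0 →
      AbelianDeformation.tr j k b ∈ rangeT f → AbelianDeformation.tr i k c ∈ rangeT f →
      AbelianDeformation.tr i j (c / b) ∈ rangeT f := fun {i j k} hij hjk {b c} hb h h' =>
    tr_left_mem hd hr hij hjk one_ne_zero (hf.tr i j hij).choose_spec hb h h'
  let p : Fin n := ⟨0, by omega⟩
  let r : Fin n := ⟨1, by omega⟩
  let q : Fin n := ⟨n - 1, by omega⟩
  have hpr : p < r := Fin.lt_def.2 Nat.zero_lt_one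
  have hrq : r < q := Fin.lt_def.2 (by simp only [r, q]; omega)
  have hpq := hpr.trans hrq
  have hp : ∀ i, p ≤ i := fun i => Fin.le_def.2 (Nat.zero_le _)
  have hq : ∀ k : Fin n, k ≤ q := fun k => Fin.le_def.2 (by have := k.2; simp only [q]; omega)
  -- Every root is compared with the corner `(p, q)`: commutators with transvections of parameter 1
  -- move a parameter there, and definable division moves it back.
  have key : ∀ i j, i < j → ∀ a : K, AbelianDeformation.tr i j a ∈ rangeT f ↔
      AbelianDeformation.tr p q a ∈ rangeT f := by
    intro i j hij a
    have h1 : AbelianDeformation.tr i j a ∈ rangeT f ↔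
        AbelianDeformation.tr i q a ∈ rangeT f := by
      rcases (hq j).lt_or_eq with hj | rfl
      · constructor
        · intro h
          simpa using tr_mul_mem hij hj h (hone j q hj)
        · intro h
          simpa using hleft hij hj one_ne_zero (hone j q hj) h
      · rfl
    rw [h1]
    rcases (hp i).lt_or_eq with hi | rfl
    · constructor
      · intro h
        simpa using tr_mul_mem hi (hij.trans_le (hq j)) (hone p i hi) h
      · exact tr_right_mem hf hi (hij.trans_le (hq j))
    · rfl
  refine ⟨{ carrier := {a | AbelianDeformation.tr p q a ∈ rangeT f}, one_mem' := hone p q hpq,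
            zero_mem' := ?_, add_mem' := ?_, mul_mem' := ?_, neg_mem' := ?_, inv_mem' := ?_ }, key⟩
  · intro a b ha hb
    exact tr_mul_mem hpr hrq ((key p r hpr a).2 ha) ((key r q hrq b).2 hb)
  · intro a b ha hb
    change AbelianDeformation.tr p q (a + b) ∈ rangeT f
    rw [tr_add hpq]
    exact (rangeT f).mul_mem ha hb
  · change AbelianDeformation.tr p q 0 ∈ rangeT f
    rw [tr_zero]
    exact (rangeT f).one_mem
  · intro a ha
    change AbelianDeformation.tr p q (-a) ∈ rangeT f
    rw [tr_neg hpq]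
    exact (rangeT f).inv_mem ha
  · intro a ha
    change AbelianDeformation.tr p q a⁻¹ ∈ rangeT f
    by_cases ha0 : a = 0
    · rw [ha0, inv_zero, tr_zero]
      exact (rangeT f).one_mem
    · have := hleft hpr hrq ha0 ((key r q hrq a).2 ha) (hone p q hpq)
      rw [one_div] at this
      exact (key p r hpr _).1 this

/-- The coordinate field of a framed elementary subgroup is elementarily equivalent to `K`. -/
theorem IsFrame.fieldElemEquiv (hf : IsFrame f) {p r q : Fin n} (hpr : p < r) (hrq : r < q)
    {A : Type*} [Field A] (κ : A →+* K)
    (hκ : ∀ a, AbelianDeformation.tr p q a ∈ rangeT f ↔ ∃ b, κ b = a) : FieldElemEquiv A K := by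
  have hpq := hpr.trans hrq
  obtain ⟨d, hd, hr⟩ := hf.diag
  obtain ⟨mpr, hmpr⟩ := hf.tr p r hpr
  obtain ⟨mrq, hmrq⟩ := hf.tr r q hrq
  obtain ⟨mpq, hmpq⟩ := hf.tr p q hpq
  let := FirstOrder.Ring.compatibleRingOfRing A
  let := FirstOrder.Ring.compatibleRingOfRing K
  let κ' : A ↪[Language.ring] K :=
    { toFun := κ
      inj' := κ.injective
      map_fun' := fun {k} F x => by
        cases F with
        | add => exact κ.map_add _ _
        | mul => exact κ.map_mul _ _
        | neg => exact κ.map_neg _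
        | zero => exact κ.map_zero
        | one => exact κ.map_one
      map_rel' := fun R => nomatch R }
  refine elementarilyEquivalent_of_coded (L := groupLanguage) (L₁ := Language.ring)
    (j := AbelianDeformation.tr p q) f κ' (tr_injective hpq) ?_ (fun k F => ?_) hκ
  · refine (DefTerm.mem_tr hd hr hpq one_ne_zero hmpq (DefTerm.var ())).congr fun v => ?_
    simp only [Set.mem_range, eq_comm]
  · cases F with
    | add =>
      refine ⟨_, DefPred.eq (DefTerm.var (Sum.inr ()))
        ((DefTerm.var (Sum.inl 0)).mul (DefTerm.var (Sum.inl 1))), fun a => ?_⟩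
      rw [← tr_add hpq, (tr_injective hpq).eq_iff]
      rfl
    | neg =>
      refine ⟨_, DefPred.eq (DefTerm.var (Sum.inr ())) (DefTerm.var (Sum.inl 0)).inv, fun a => ?_⟩
      rw [← tr_neg hpq, (tr_injective hpq).eq_iff]
      rfl
    | zero =>
      refine ⟨_, DefPred.eq (DefTerm.var (Sum.inr ())) DefTerm.one, fun a => ?_⟩
      rw [← tr_zero p q, (tr_injective hpq).eq_iff]
      rfl
    | one =>
      refine ⟨_, DefPred.eq (DefTerm.var (Sum.inr ())) (DefTerm.param mpq), fun a => ?_⟩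
      rw [hmpq, (tr_injective hpq).eq_iff]
      rfl
    | mul =>
      -- Both factors are moved from the root `(p, q)` to the roots `(p, r)` and `(r, q)` by means
      -- of the frame; the commutator of the results carries the product of the parameters.
      refine ⟨fun w => ∃ y, ∃ z, (∃ a, y = AbelianDeformation.tr p r a) ∧
        (∃ b, z = AbelianDeformation.tr r q b) ∧ y * f mrq = w (.inl 0) * (f mrq * y) ∧
        f mpr * z = w (.inl 1) * (z * f mpr) ∧ y * z = w (.inr ()) * (z * y), ?_, fun a => ?_⟩
      · refine DefPred.exists_one (P := fun (w : Fin 2 ⊕ Unit → T n K) y => ∃ z, (∃ a, y = AbelianDeformation.tr p r a) ∧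
          (∃ b, z = AbelianDeformation.tr r q b) ∧ y * f mrq = w (.inl 0) * (f mrq * y) ∧
          f mpr * z = w (.inl 1) * (z * f mpr) ∧ y * z = w (.inr ()) * (z * y)) ?_
        refine DefPred.exists_one (α := (Fin 2 ⊕ Unit) ⊕ Unit)
          (P := fun (w : (Fin 2 ⊕ Unit) ⊕ Unit → T n K) z => (∃ a, w (.inr ()) = AbelianDeformation.tr p r a) ∧
          (∃ b, z = AbelianDeformation.tr r q b) ∧
          w (.inr ()) * f mrq = w (.inl (.inl 0)) * (f mrq * w (.inr ())) ∧
          f mpr * z = w (.inl (.inl 1)) * (z * f mpr) ∧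
          w (.inr ()) * z = w (.inl (.inr ())) * (z * w (.inr ()))) ?_
        refine (DefTerm.mem_tr hd hr hpr one_ne_zero hmpr (DefTerm.var _)).and
          ((DefTerm.mem_tr hd hr hrq one_ne_zero hmrq (DefTerm.var _)).and
          ((DefPred.eq ?_ ?_).and ((DefPred.eq ?_ ?_).and (DefPred.eq ?_ ?_))))
        · exact DefTerm.mul (DefTerm.var _) (DefTerm.param _)
        · exact DefTerm.mul (DefTerm.var _) (DefTerm.mul (DefTerm.param _) (DefTerm.var _))
        · exact DefTerm.mul (DefTerm.param _) (DefTerm.var _)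
        · exact DefTerm.mul (DefTerm.var _) (DefTerm.mul (DefTerm.var _) (DefTerm.param _))
        · exact DefTerm.mul (DefTerm.var _) (DefTerm.var _)
        · exact DefTerm.mul (DefTerm.var _) (DefTerm.mul (DefTerm.var _) (DefTerm.var _))
      · change _ ↔ a (.inr ()) = a (.inl 0) * a (.inl 1)
        constructor
        · rintro ⟨_, _, ⟨b, rfl⟩, ⟨c, rfl⟩, h1, h2, h3⟩
          rw [hmrq, tr_mul_tr hpr hrq, mul_left_inj, mul_one] at h1
          rw [hmpr, tr_mul_tr hpr hrq, mul_left_inj, one_mul] at h2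
          rw [tr_mul_tr hpr hrq, mul_left_inj] at h3
          rw [← tr_injective hpq h1, ← tr_injective hpq h2, tr_injective hpq h3]
        · intro h
          refine ⟨_, _, ⟨a (.inl 0), rfl⟩, ⟨a (.inl 1), rfl⟩, ?_, ?_, ?_⟩
          · rw [hmrq, tr_mul_tr hpr hrq, mul_one]
          · rw [hmpr, tr_mul_tr hpr hrq, one_mul]
          · beta_reduce
            rw [h, tr_mul_tr hpr hrq]

end CoordinateField

/-! ### The center and the torus -/

section Torus

open FirstOrder FirstOrder.Language

attribute [local instance] groupStructure

variable {n : ℕ} {K : Type*} [Field K]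

theorem mem_center_T_iff [Infinite K] {g : T n K} :
    g ∈ Subgroup.center (T n K) ↔ IsDiagT g ∧ ∀ i j, i < j → mat g i i = mat g j j := by
  rw [Subgroup.mem_center_iff]
  constructor
  · intro h
    obtain ⟨x, hx⟩ := exists_regular n K
    have hg := (isDiagT_dg x).isDiagT_of_comm (isRegularT_dg hx) (h (dg x)).symm
    refine ⟨hg, fun i j hij => ?_⟩
    have h1 := h (tr i j 1)
    rw [hg.mul_tr hij, mul_left_inj] at h1
    have h2 := tr_injective hij h1
    rw [mul_one, eq_comm, div_eq_one_iff_eq (mat_diag_ne_zero g j)] at h2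
    exact h2
  · rintro ⟨hg, h⟩ x
    apply mat_injective
    ext i j
    rw [hg.mul_apply, hg.apply_mul, mul_comm]
    rcases lt_trichotomy i j with hij | rfl | hij
    · rw [h i j hij]
    · rfl
    · rw [mat_upper x hij, mul_zero, mul_zero]

/-- The center of `T n K` is the group of scalar matrices. -/
theorem nonempty_center_mulEquiv [Infinite K] (hn : 0 < n) :
    Nonempty (Subgroup.center (T n K) ≃* Kˣ) := by
  let p : Fin n := ⟨0, hn⟩
  let φ : Subgroup.center (T n K) →* Kˣ :=
    MonoidHom.mk' (fun z => diagUnits z.1 p) fun a b => Units.ext (mat_mul_diag _ _ _)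
  have hz : ∀ (z : Subgroup.center (T n K)) i, mat z.1 i i = mat z.1 p p := by
    intro z i
    rcases (Fin.le_def.2 (Nat.zero_le _) : p ≤ i).lt_or_eq with hi | rfl
    · exact ((mem_center_T_iff.1 z.2).2 p i hi).symm
    · rfl
  refine ⟨MulEquiv.ofBijective φ ⟨fun a b hab => ?_, fun c => ?_⟩⟩
  · have h1 : mat a.1 p p = mat b.1 p p := congrArg Units.val hab
    apply Subtype.ext
    apply mat_injective
    ext i j
    by_cases hij : i = j
    · subst hij
      rw [hz a, hz b, h1]
    · rw [(mem_center_T_iff.1 a.2).1 i j hij, (mem_center_T_iff.1 b.2).1 i j hij]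
  · refine ⟨⟨dg fun _ => c, mem_center_T_iff.2 ⟨isDiagT_dg _, fun i j _ => ?_⟩⟩, Units.ext ?_⟩
    · rw [mat_dg_diag, mat_dg_diag]
    · exact mat_dg_diag _ _

variable {M : Type*} [Group M] {f : M ↪ₑ[groupLanguage] T n K}

/-- The diagonal part of `f m` satisfies the definable condition in `T n K`. It need not be the
element found in the image. -/
theorem IsFrame.exists_diag_mul_inv_mem_UT [Infinite K] (hf : IsFrame f) (m : M) :
    ∃ x, IsDiagT (f x) ∧ f m * (f x)⁻¹ ∈ UT n K := by
  obtain ⟨d, hd, hr⟩ := hf.diag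
  refine DefPred.exists_point_one f (P := fun x => IsDiagT x ∧ f m * x⁻¹ ∈ UT n K)
    ((DefTerm.isDiagT hd hr (DefTerm.var _)).and
      (DefTerm.mem_UT ((DefTerm.param m).mul (DefTerm.var ()).inv)))
    ⟨dg (diagUnits (f m)), isDiagT_dg _, fun i => ?_⟩
  change mat _ i i = 1
  rw [mat_mul_diag, mat_inv_diag, mat_dg_diag]
  exact mul_inv_cancel₀ (mat_diag_ne_zero (f m) i)

/-- Prescribing the ratios amounts to prescribing how a diagonal element conjugates each `tr i q 1`,
a definable condition solved in `T n K` by an explicit diagonal matrix. -/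
theorem IsFrame.exists_diag_ratio (hf : IsFrame f) {q : Fin n} (b : Fin n → Kˣ)
    (hb : ∀ i, i < q → AbelianDeformation.tr i q (b i : K) ∈ rangeT f) :
    ∃ x, IsDiagT (f x) ∧ ∀ i, i < q → mat (f x) i i / mat (f x) q q = b i := by
  obtain ⟨d, hd, hr⟩ := hf.diag
  choose t ht using fun i : {i // i < q} => hf.tr i.1 q i.2
  choose s hs using fun i : {i // i < q} => mem_rangeT.1 (hb i.1 i.2)
  obtain ⟨x, hx, hx'⟩ := DefPred.exists_point_one f
    (P := fun x => IsDiagT x ∧ ∀ i : {i // i < q}, x * f (t i) = f (s i) * x)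
    ((DefTerm.isDiagT hd hr (DefTerm.var _)).and (DefPred.forall_finite fun i =>
      DefPred.eq (DefTerm.mul (DefTerm.var _) (DefTerm.param _))
        (DefTerm.mul (DefTerm.param _) (DefTerm.var _))))
    ⟨dg (Function.update b q 1), isDiagT_dg _, fun i => by
      rw [ht, hs, (isDiagT_dg _).mul_tr i.2, mat_dg_diag, mat_dg_diag, Function.update_self,
        Function.update_of_ne i.2.ne]
      simp⟩
  refine ⟨x, hx, fun i hi => ?_⟩
  have h := hx' ⟨i, hi⟩
  rw [ht, hs, hx.mul_tr hi, mul_left_inj, mul_one] at h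
  exact tr_injective hi h

theorem IsFrame.ratio_mem {S : Subfield K} (hf : IsFrame f)
    (hS : ∀ i j, i < j → ∀ a, AbelianDeformation.tr i j a ∈ rangeT f ↔ a ∈ S) {x : M}
    (hx : IsDiagT (f x)) {i q : Fin n} (hi : i ≤ q) : mat (f x) i i / mat (f x) q q ∈ S := by
  rcases hi.lt_or_eq with hi | rfl
  · rw [← hS i q hi]
    have h := hx.mul_tr hi (1 : K)
    rw [mul_one, ← mul_inv_eq_iff_eq_mul] at h
    rw [← h]
    exact (rangeT f).mul_mem ((rangeT f).mul_mem (apply_mem_rangeT f x) (hf.tr i q hi))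
      ((rangeT f).inv_mem (apply_mem_rangeT f x))
  · rw [div_self (mat_diag_ne_zero _ _)]
    exact S.one_mem

end Torus

/-! ### Extensions by abelian groups and cocycles -/

section Assembly

/-- A group `H` that is the product of a normal subgroup `ι U` and an abelian subgroup `j D`, whose
center is the kernel of `p : D →* B`, is the semidirect product of `U` and an abelian extension of
its center by `B`. -/
theorem exists_symmCocycle_mulEquiv {H U B D : Type*} [Group H] [Group U] [CommGroup B]
    [CommGroup D] (j : D →* H) (hj : Function.Injective j) (p : D →* B)
    (hp : Function.Surjective p) (hcenter : ∀ z ∈ Subgroup.center H, ∃ x, j x = z)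
    (hker : ∀ x, p x = 1 ↔ j x ∈ Subgroup.center H) (ι : U →* H)
    (act : B →* MulAut U) (hact : ∀ x u, j x * ι u * (j x)⁻¹ = ι (act (p x) u))
    (hdec : ∀ h, ∃ u x, h = ι u * j x) (hint : ∀ u x, ι u = j x → u = 1) :
    ∃ f : SymmCocycle B (Subgroup.center H),
      Nonempty (H ≃* U ⋊[act.comp (AbExt.proj f)] AbExt f) := by
  classical
  -- A section normalized at 1 makes its defect `σ a * σ b / σ (a * b)` a normalized cocycle; the
  -- defect is symmetric because `D` is commutative.
  obtain ⟨σ, hσ, hσ1⟩ : ∃ σ : B → D, (∀ b, p (σ b) = b) ∧ σ 1 = 1 := by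
    choose σ hσ using hp
    refine ⟨Function.update σ 1 1, fun b => ?_, by simp⟩
    by_cases hb : b = 1
    · subst hb; simp
    · rw [Function.update_of_ne hb, hσ]
  have hmem : ∀ a b, j (σ a * σ b / σ (a * b)) ∈ Subgroup.center H := fun a b => by
    rw [← hker, map_div, map_mul, hσ, hσ, hσ, div_self']
  let f : SymmCocycle B (Subgroup.center H) :=
    { toFun := fun a b => ⟨j (σ a * σ b / σ (a * b)), hmem a b⟩
      cocycle := fun x y z => Subtype.ext (by
        change j _ * j _ = j _ * j _
        rw [← map_mul, ← map_mul]
        congr 1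
        rw [div_mul_div_comm, div_mul_div_comm, div_eq_div_iff_mul_eq_mul, mul_assoc x y z]
        simp only [mul_comm, mul_left_comm])
      one_left := fun x => Subtype.ext (by simp [hσ1])
      one_right := fun x => Subtype.ext (by simp [hσ1])
      symm := fun x y => Subtype.ext (by
        change j _ = j _
        rw [mul_comm x y, mul_comm (σ x)]) }
  have hcomm : ∀ (z : Subgroup.center H) (h : H), h * z = z * h := fun z =>
    Subgroup.mem_center_iff.1 z.2
  let φ : AbExt f →* H := MonoidHom.mk' (fun w => w.z * j (σ w.b)) fun w w' => by
    change ((w.z : H) * w'.z * j (σ w.b * σ w'.b / σ (w.b * w'.b))) * j (σ (w.b * w'.b)) =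
      w.z * j (σ w.b) * (w'.z * j (σ w'.b))
    rw [mul_assoc ((w.z : H) * w'.z), ← map_mul, div_mul_cancel, map_mul, mul_assoc, mul_assoc,
      ← mul_assoc (j (σ w.b)), hcomm w'.z, mul_assoc]
  have hφ : ∀ w, φ w = w.z * j (σ w.b) := fun _ => rfl
  let Φ : U ⋊[act.comp (AbExt.proj f)] AbExt f →* H := SemidirectProduct.lift ι φ fun w => by
    ext u
    change ι (act w.b u) = φ w * ι u * (φ w)⁻¹
    have h := hact (σ w.b) u
    rw [hσ] at h
    rw [hφ, ← h]
    refine (eq_mul_inv_of_mul_eq (hcomm w.z _)).trans ?_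
    group
  have hΦ : ∀ w, Φ w = ι w.left * (w.right.z * j (σ w.right.b)) := fun _ => rfl
  refine ⟨f, ⟨(MulEquiv.ofBijective Φ ⟨?_, fun h => ?_⟩).symm⟩⟩
  · rw [injective_iff_map_eq_one]
    intro w hw
    rw [hΦ] at hw
    obtain ⟨x, hx⟩ := hcenter _ w.right.z.2
    have h1 : w.left = 1 := by
      refine hint _ (x * σ w.right.b)⁻¹ ?_
      rw [map_inv, map_mul, hx]
      exact eq_inv_of_mul_eq_one_left hw
    rw [h1, map_one, one_mul, ← hx, ← map_mul, ← map_one j] at hw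
    have h2 := hj hw
    have h3 : w.right.b = 1 := by
      have h4 := congrArg p h2
      rw [map_mul, (hker x).2 (hx ▸ w.right.z.2), hσ, one_mul, map_one] at h4
      exact h4
    rw [h3, hσ1, mul_one] at h2
    rw [h2, map_one] at hx
    refine SemidirectProduct.ext h1 (AbExt.ext ?_ h3)
    exact Subtype.ext hx.symm
  · obtain ⟨u, x, rfl⟩ := hdec h
    have hz : j (x / σ (p x)) ∈ Subgroup.center H := by
      rw [← hker, map_div, hσ, div_self']
    refine ⟨⟨u, ⟨⟨_, hz⟩, p x⟩⟩, ?_⟩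
    rw [hΦ]
    change ι u * (j (x / σ (p x)) * j (σ (p x))) = _
    rw [← map_mul, div_mul_cancel]

end Assembly

/-! ### The structure of elementary subgroups of `T n K` -/

section Structure

open FirstOrder FirstOrder.Language

attribute [local instance] groupStructure

variable {n : ℕ} {K L : Type*} [Field K] [Field L]

/-- The entrywise image of a triangular matrix under a homomorphism of fields. -/
noncomputable def mapT (κ : L →+* K) (g : T n L) : T n K := ofMat ((mat g).map κ)

theorem mat_mapT (κ : L →+* K) (g : T n L) : mat (mapT κ g) = (mat g).map κ :=
  mat_ofMat (fun i j h => by rw [Matrix.map_apply, mat_upper g h, map_zero]) fun i => by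
    rw [Matrix.map_apply]
    exact (map_ne_zero κ).2 (mat_diag_ne_zero g i)

theorem mapT_mul (κ : L →+* K) (g h : T n L) : mapT κ (g * h) = mapT κ g * mapT κ h := by
  apply mat_injective
  rw [mat_mul, mat_mapT, mat_mapT, mat_mapT, mat_mul, Matrix.map_mul]

theorem mapT_injective (κ : L →+* K) :
    Function.Injective (mapT κ : T n L → T n K) := by
  intro g h e
  rw [← mat_inj, mat_mapT, mat_mapT] at e
  exact mat_injective (Matrix.map_injective κ.injective e)

theorem mapT_mem_UT (κ : L →+* K) {u : T n L} (hu : u ∈ UT n L) : mapT κ u ∈ UT n K := by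
  intro i
  change mat _ i i = 1
  rw [mat_mapT, Matrix.map_apply, mem_UT.1 hu i, map_one]

theorem IsDiagT.conj_apply {g : T n K} (hg : IsDiagT g) (h : T n K) (i j : Fin n) :
    mat (g * h * g⁻¹) i j = mat g i i * mat h i j * (mat g j j)⁻¹ := by
  rw [hg.inv.apply_mul, hg.mul_apply, mat_inv_diag]

theorem mem_B_iff {g : T n K} {q : Fin n} (hq : (q : ℕ) + 1 = n) :
    g ∈ B n K ↔ IsDiagT g ∧ mat g q q = 1 := by
  constructor
  · exact fun h => ⟨h.1, h.2 q hq⟩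
  · refine fun h => ⟨h.1, fun i hi => ?_⟩
    obtain rfl : i = q := Fin.ext (by omega)
    exact h.2

/-- An elementary subgroup of `T n K` with a frame is an abelian deformation over its coordinate
field. -/
theorem IsFrame.exists_mulEquiv_deformedT [Infinite K] {M : Type*} [Group M]
    {f : M ↪ₑ[groupLanguage] T n K} (hf : IsFrame f) (hn : 0 < n) (κ : L →+* K)
    (hκ : ∀ i j, i < j → ∀ a, AbelianDeformation.tr i j a ∈ rangeT f ↔ a ∈ κ.fieldRange) :
    ∃ c : SymmCocycle (B n L) (Subgroup.center M), Nonempty (M ≃* DeformedT c) := by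
  let q : Fin n := ⟨n - 1, by omega⟩
  have hqn : (q : ℕ) + 1 = n := by simp only [q]; omega
  have hq : ∀ k : Fin n, k ≤ q := fun k => Fin.le_def.2 (by have := k.2; simp only [q]; omega)
  have hmul : ∀ a b, f (a * b) = f a * f b := (toMonoidHom f).map_mul
  have hinv : ∀ a, f a⁻¹ = (f a)⁻¹ := (toMonoidHom f).map_inv
  have hone : f 1 = 1 := (toMonoidHom f).map_one
  let D : Subgroup M :=
    { carrier := {x | IsDiagT (f x)}
      one_mem' := fun i j hij => by rw [hone, mat_one, Matrix.one_apply_ne hij]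
      mul_mem' := fun {a b} (ha : IsDiagT (f a)) (hb : IsDiagT (f b)) => by
        change IsDiagT (f (a * b))
        rw [hmul]
        exact ha.mul hb
      inv_mem' := fun {a} (ha : IsDiagT (f a)) => by
        change IsDiagT (f a⁻¹)
        rw [hinv]
        exact ha.inv }
  let : CommGroup D := { (inferInstance : Group D) with
    mul_comm := fun a b => Subtype.ext (f.injective (by
      change f (a * b) = f (b * a)
      rw [hmul, hmul, IsDiagT.comm a.2 b.2])) }
  have hB : ∀ b : B n L, IsDiagT (b : T n L) ∧ mat (b : T n L) q q = 1 :=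
    fun b => (mem_B_iff hqn).1 b.2
  have hBext : ∀ b b' : B n L, (∀ i, κ (mat (b : T n L) i i) = κ (mat (b' : T n L) i i)) →
      b = b' := by
    intro b b' h
    apply Subtype.ext
    apply mat_injective
    ext i j
    by_cases hij : i = j
    · subst hij
      exact κ.injective (h i)
    · rw [(hB b).1 i j hij, (hB b').1 i j hij]
  -- Only ratios of diagonal entries are known to lie in the coordinate field. Dividing by the last
  -- entry gives an element of `B n L` and kills precisely the scalar matrices.
  have hp : ∀ x : D, ∃ b : B n L, ∀ i, κ (mat (b : T n L) i i) =
      mat (f x) i i / mat (f x) q q := by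
    intro x
    choose y hy using fun i => hf.ratio_mem hκ x.2 (hq i)
    have hy0 : ∀ i, y i ≠ 0 := fun i h => by
      have := hy i
      rw [h, map_zero, eq_comm] at this
      exact div_ne_zero (mat_diag_ne_zero _ _) (mat_diag_ne_zero _ _) this
    refine ⟨⟨dg fun i => Units.mk0 (y i) (hy0 i), (mem_B_iff hqn).2 ⟨isDiagT_dg _, ?_⟩⟩,
      fun i => ?_⟩
    · rw [mat_dg_diag, Units.val_mk0]
      apply κ.injective
      rw [hy, map_one, div_self (mat_diag_ne_zero _ _)]
    · rw [mat_dg_diag, Units.val_mk0, hy]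
  choose p₀ hp₀ using hp
  let p : D →* B n L := MonoidHom.mk' p₀ fun a b => hBext _ _ fun i => by
    change _ = κ (mat ((p₀ a : T n L) * (p₀ b : T n L)) i i)
    rw [hp₀, mat_mul_diag, map_mul, hp₀, hp₀, Subgroup.coe_mul, hmul, mat_mul_diag, mat_mul_diag,
      mul_div_mul_comm]
  have hpp : ∀ x i, κ (mat (p x : T n L) i i) = mat (f x) i i / mat (f x) q q := hp₀
  have hι : ∀ u : UT n L, ∃ m, f m = mapT κ u := fun u =>
    (mem_iff_entries_mem hκ (mapT_mem_UT κ u.2)).2 fun i j => by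
      rw [mat_mapT]
      exact ⟨_, rfl⟩
  choose ι₀ hι₀ using hι
  let ι : UT n L →* M := MonoidHom.mk' ι₀ fun u u' => f.injective (by
    rw [hι₀, hmul, hι₀, hι₀, Subgroup.coe_mul, mapT_mul])
  have hιι : ∀ u, f (ι u) = mapT κ u := hι₀
  refine exists_symmCocycle_mulEquiv D.subtype Subtype.val_injective p (fun b => ?_)
    (fun z hz => ?_) (fun x => ?_) ι
    (MulAut.conjNormal.comp (B n L).subtype) (fun x u => ?_) (fun h => ?_) (fun u x h => ?_)
  · obtain ⟨x, hx, hx'⟩ := hf.exists_diag_ratio (q := q)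
      (fun i => Units.map κ.toMonoidHom (diagUnits (b : T n L) i))
      fun i hi => (hκ i q hi _).2 ⟨_, rfl⟩
    refine ⟨⟨x, hx⟩, hBext _ _ fun i => ?_⟩
    rw [hpp]
    rcases (hq i).lt_or_eq with hi | rfl
    · exact hx' i hi
    · rw [(hB b).2, map_one, div_self (mat_diag_ne_zero _ _)]
  · exact ⟨⟨z, (mem_center_T_iff.1 ((mem_center_iff_map f z).1 hz)).1⟩, rfl⟩
  · change _ ↔ (x : M) ∈ _
    rw [mem_center_iff_map f, mem_center_T_iff]
    constructor
    · intro h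
      have h1 : ∀ i, mat (f x) i i = mat (f x) q q := by
        intro i
        have h2 := hpp x i
        rw [h, eq_comm] at h2
        change _ = κ (mat (1 : T n L) i i) at h2
        rw [mat_one, Matrix.one_apply_eq, map_one, div_eq_one_iff_eq (mat_diag_ne_zero _ _)] at h2
        exact h2
      exact ⟨x.2, fun i j _ => by rw [h1 i, h1 j]⟩
    · intro h
      refine hBext _ _ fun i => ?_
      change _ = κ (mat (1 : T n L) i i)
      rw [hpp, mat_one, Matrix.one_apply_eq, map_one]
      rcases (hq i).lt_or_eq with hi | rfl
      · rw [h.2 i q hi, div_self (mat_diag_ne_zero _ _)]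
      · rw [div_self (mat_diag_ne_zero _ _)]
  · apply f.injective
    change f ((x : M) * ι u * (x : M)⁻¹) = _
    rw [hmul, hmul, hinv, hιι, hιι]
    apply mat_injective
    ext i j
    have hxd : IsDiagT (f x) := x.2
    change _ = mat (mapT κ ((p x : T n L) * (u : T n L) * (p x : T n L)⁻¹)) i j
    rw [hxd.conj_apply, mat_mapT, mat_mapT, Matrix.map_apply, Matrix.map_apply,
      (hB (p x)).1.conj_apply, map_mul, map_mul, map_inv₀, hpp, hpp]
    have h1 := mat_diag_ne_zero (f x) q
    have h2 := mat_diag_ne_zero (f x) j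
    field_simp
  · obtain ⟨x, hx, hu⟩ := hf.exists_diag_mul_inv_mem_UT h
    have h1 : f h * (f x)⁻¹ ∈ rangeT f :=
      (rangeT f).mul_mem (apply_mem_rangeT f h) ((rangeT f).inv_mem (apply_mem_rangeT f x))
    choose y hy using (mem_iff_entries_mem hκ hu).1 h1
    have hy1 : mat (ofMat (Matrix.of y)) = Matrix.of y := by
      refine mat_ofMat (fun i j hij => κ.injective ?_) fun i h0 => ?_
      · rw [Matrix.of_apply, hy, mat_upper _ hij, map_zero]
      · have := hy i i
        rw [Matrix.of_apply] at h0
        rw [h0, map_zero, eq_comm] at this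
        exact mat_diag_ne_zero _ _ this
    refine ⟨⟨ofMat (Matrix.of y), fun i => κ.injective ?_⟩, ⟨x, hx⟩, f.injective ?_⟩
    · change κ (mat _ i i) = _
      rw [hy1, Matrix.of_apply, hy, mem_UT.1 hu, map_one]
    · change f h = f (_ * x)
      rw [hmul, hιι, ← mul_inv_eq_iff_eq_mul]
      apply mat_injective
      ext i j
      rw [mat_mapT, hy1, Matrix.map_apply, Matrix.of_apply, hy]
  · have h1 : IsDiagT (mapT κ (u : T n L)) := by
      rw [← hιι, h]
      exact x.2
    apply Subtype.ext
    apply mapT_injective κ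
    apply mat_injective
    ext i j
    by_cases hij : i = j
    · subst hij
      exact (mapT_mem_UT κ u.2 i).trans (mapT_mem_UT κ (UT n L).one_mem i).symm
    · rw [h1 i j hij, mat_mapT, Matrix.map_apply]
      change _ = κ (mat (1 : T n L) i j)
      rw [mat_one, Matrix.one_apply_ne hij, map_zero]

/-- The diagonal embedding of `T n F` is framed. -/
theorem isFrame_of_mat_eq [Infinite L] (κ : L →+* K) (δ : T n L ↪ₑ[groupLanguage] T n K)
    (hδ : ∀ g r s, mat (δ g) r s = κ (mat g r s)) : IsFrame δ := by
  constructor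
  · obtain ⟨x, hx⟩ := exists_regular n L
    refine ⟨dg x, fun i j hij => ?_, fun i j hij => ?_⟩
    · rw [hδ, isDiagT_dg x i j hij, map_zero]
    · simp only [hδ] at hij
      exact isRegularT_dg hx (κ.injective hij)
  · intro i j hij
    refine ⟨tr i j 1, mat_injective (Matrix.ext fun k l => ?_)⟩
    rw [hδ, tr_apply hij, tr_apply hij, map_add]
    congr 1 <;> split_ifs <;> simp

theorem tr_mem_rangeT_iff (κ : L →+* K) (δ : T n L ↪ₑ[groupLanguage] T n K)
    (hδ : ∀ g r s, mat (δ g) r s = κ (mat g r s)) {i j : Fin n} (hij : i < j) (a : K) :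
    tr i j a ∈ rangeT δ ↔ ∃ b, κ b = a := by
  constructor
  · rintro ⟨g, hg⟩
    refine ⟨mat g i j, ?_⟩
    rw [← hδ, ← toMonoidHom_apply, hg, tr_apply_self hij]
  · rintro ⟨b, rfl⟩
    refine ⟨tr i j b, mat_injective (Matrix.ext fun k l => ?_)⟩
    rw [toMonoidHom_apply, hδ, tr_apply hij, tr_apply hij, map_add]
    congr 1 <;> split_ifs <;> simp

end Structure

end AbelianDeformation

open AbelianDeformation in
theorem theoremA3 (n : ℕ) (hn : 3 ≤ n) {F : Type u} [Field F] [Infinite F] (hF : ringChar F ≠ 2)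
    {H : Type v} [Group H] (hH : AbelianDeformation.GroupElemEquiv H (AbelianDeformation.T n F)) :
    ∃ (L : Type v) (_ : Field L)
      (f : AbelianDeformation.SymmCocycle (AbelianDeformation.B n L) (Subgroup.center H)),
      AbelianDeformation.FieldElemEquiv L F ∧
      AbelianDeformation.GroupElemEquiv (Subgroup.center H)
        (Subgroup.center (AbelianDeformation.T n F)) ∧
      Nonempty (Subgroup.center (AbelianDeformation.T n F) ≃* Fˣ) ∧
      AbelianDeformation.GroupElemEquiv (Subgroup.center H) Fˣ ∧
      Nonempty (H ≃* AbelianDeformation.DeformedT f) := by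
  obtain ⟨K, _, κ, f₀, δ, hδ⟩ := exists_elementaryEmbedding_T hH
  have : Infinite K := Infinite.of_injective κ κ.injective
  obtain ⟨f, hf⟩ := exists_isFrame f₀
  obtain ⟨S, hS⟩ := hf.exists_subfield hn
  let p : Fin n := ⟨0, by omega⟩
  let r : Fin n := ⟨1, by omega⟩
  let q : Fin n := ⟨2, by omega⟩
  have hpr : p < r := Fin.lt_def.2 Nat.zero_lt_one
  have hrq : r < q := Fin.lt_def.2 Nat.one_lt_two
  have hpq := hpr.trans hrq
  choose m hm using fun a : S => (hS p q hpq a).2 a.2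
  -- The subfield lives in the universe of `K`, but its elements are the parameters of distinct
  -- elements of `H`, so a copy exists in the universe of `H`.
  have : Small.{v} S := small_of_injective (f := m) fun a b hab => Subtype.ext
    (tr_injective hpq (by rw [← hm, ← hm, hab]))
  let ε : Shrink.{v} S →+* K := S.subtype.comp (Shrink.ringEquiv S : Shrink.{v} S →+* S)
  have hε : ∀ a, a ∈ S ↔ ∃ b, ε b = a := fun a =>
    ⟨fun ha => ⟨(Shrink.ringEquiv S).symm ⟨a, ha⟩, by simp [ε]⟩,
      by rintro ⟨b, rfl⟩; exact Subtype.prop _⟩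
  have hLK : FieldElemEquiv (Shrink.{v} S) K :=
    hf.fieldElemEquiv hpr hrq ε fun a => (hS p q hpq a).trans (hε a)
  -- The diagonal copy of `T n F` is itself a framed elementary subgroup, with coordinate field the
  -- image of `F`.
  have hFK : FieldElemEquiv F K :=
    (isFrame_of_mat_eq κ δ hδ).fieldElemEquiv hpr hrq κ (tr_mem_rangeT_iff κ δ hδ hpq)
  have hZ : GroupElemEquiv (Subgroup.center H) (Subgroup.center (T n F)) :=
    (center_groupElemEquiv f).trans (center_groupElemEquiv δ).symm
  obtain ⟨e⟩ := nonempty_center_mulEquiv (n := n) (K := F) (by omega)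
  obtain ⟨c, hc⟩ := hf.exists_mulEquiv_deformedT (by omega) ε
    fun i j hij a => (hS i j hij a).trans (hε a)
  exact ⟨Shrink.{v} S, inferInstance, c, hLK.trans hFK.symm, hZ, ⟨e⟩,
    hZ.trans (GroupElemEquiv.of_mulEquiv e), hc⟩
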